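/- **Setting.** Let $\Theta\subseteq\mathbb{R}^d$, let $\mu$ be a $\sigma$-finite measure on $\mathbb{R}^m$, and let $\{p_\theta:\theta\in\Theta\}$ be probability densities with respect to $\mu$ such that $(\theta,x)\mapsto p_\theta(x)\in[0,\infty)$ is jointly measurable. Let $\mathcal{G}$ be the set of all probability measures on $\Theta$, and put $f_g(x)=\int_\Theta p_\theta(x)\,\mathrm{d}g(\theta)$ for $g\in\mathcal{G}$. For densities $f,f_0$ put $\chi(f,f_0)=\|f/f_0-1\|_{L_2(f_0\mathrm{d}\mu)}\in[0,\infty]$. Let $g_0\in\mathcal{G}$ satisfy (ID) $\Theta$ is bounded, and for any $g\in\mathcal{G}$: $\chi^2(f_g,f_{g_0})=0$ if and only if $g=g_0$. Let $q_0\equiv 1,q_1,q_2,\dots$ be polynomials in $d$ variables with $\int_\Theta q_kq_l\,\mathrm{d}g_0=\mathbf{1}\{k=l\}$ for all $k,l\ge 0$ (such a sequence exists when $g_0$ is not a finitely supported discrete measure, and only then). For $K\ge1$ let $$\mathcal{G}^{\le K}=\Big\{g\in\mathcal{G}:\ \exists\,c\in\mathbb{R}^K,\ \mathrm{d}g=\Big(1+\sum_{k=1}^K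 c_kq_k\Big)\mathrm{d}g_0\Big\},\qquad \mathcal{F}^{\le K}=\{f_g: g\in\mathcal{G}^{\le K}\}.$$ **Theorem.** For every $K\ge1$, the pair $(\mathcal{F},f_0)=(\mathcal{F}^{\le K},f_{g_0})$ satisfies: - (A1) $\chi^2(f,f_0)\in(0,\infty)$ for every $f\in\mathcal{F}\setminus\{f_0\}$; - (A2) the score set $\mathcal{S}=\{s_f:f\in\mathcal{F}\setminus\{f_0\}\}$, where $s_f=(f/f_0-1)/\chi(f,f_0)$ (with $s_f=0$ on the null set where $f_0\in\{0,\infty\}$), is $f_0\,\mathrm{d}\mu$-Donsker (its empirical process converges weakly in $\ell^\infty(\mathcal{S})$ to a tight Borel limit) and has an $f_0\,\mathrm{d}\mu$-square-integrable envelope; - (SS) $(1-t)f_0+tf\in\mathcal{F}$ for all $f\in\mathcal{F}$ and $t\in[0,1]$. Moreover, let $X_1,X_2,\dots$ be i.i.d. with density $f_{g_0}$, let $\ell_n(f)=\sum_{i=1}^n\log f(X_i)$ (with $\log 0=-\infty$), and let $\hat g_K=\hat g_{K,n}\in\mathcal{G}^{\le K}$ be any approximate maximum likelihood estimator over $\mathcal{G}^{\le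 K}$, i.e. $$\sup_{g\in\mathcal{G}^{\le K}}\ell_n(f_g)-\ell_n(f_{\hat g_K})=o_{\mathbb{P}}(1).$$ Then both $n\,\chi^2(f_{\hat g_K},f_{g_0})$ and $2\{\ell_n(f_{\hat g_K})-\ell_n(f_{g_0})\}$ converge in distribution, as $n\to\infty$, to the chi-square law with $K$ degrees of freedom. (No measurability of $\hat g_K$ is required: probabilities and convergence in distribution are understood in the outer sense of Hoffmann-Jørgensen, which is the usual sense for measurable statistics.) -/

import Mathlib

open MeasureTheory ProbabilityTheory Filter Topology
open scoped ENNReal NNReal BoundedContinuousFunction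

noncomputable section

namespace NPMixture

/-! ### Weak convergence of possibly non-measurable maps -/

/-- Outer expectation `E* T = inf {E U : U ≥ T, U measurable and integrable}`. -/
def outerExpectation {Ω : Type*} [MeasurableSpace Ω] (Q : Measure Ω) (T : Ω → ℝ) : ℝ :=
  sInf {r : ℝ | ∃ U : Ω → ℝ, Measurable U ∧ Integrable U Q ∧ (∀ ω, T ω ≤ U ω) ∧ ∫ ω, U ω ∂Q = r}

/-- Convergence in distribution (in the sense of Hoffmann-Jørgensen) of the maps `Z n`, defined on
the probability spaces `(Ω n, Q n)`, to the Borel law `L`: `E* h(Z n) → ∫ h dL` for every bounded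
continuous `h`. For measurable `Z n` this is the usual convergence in distribution. -/
def ConvergesInLaw {D : Type*} [TopologicalSpace D] [MeasurableSpace D]
    {Ω : ℕ → Type*} [∀ n, MeasurableSpace (Ω n)] (Q : ∀ n, Measure (Ω n))
    (Z : ∀ n, Ω n → D) (L : Measure D) : Prop :=
  ∀ h : D →ᵇ ℝ, Tendsto (fun n => outerExpectation (Q n) (fun ω => h (Z n ω))) atTop
    (𝓝 (∫ z, h z ∂L))

/-! ### Donsker classes -/

/-- The Banach space `ℓ^∞(T)` of bounded real functions on the index set `T`, sup norm. -/
abbrev EllInf (T : Type*) : Type _ := lp (fun _ : T => ℝ) ∞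

/-- `√n (P_n - P)` as an element of `ℓ^∞(S)`, where `P_n` is the empirical measure of the points
`x 0, …, x (n - 1)`, written as `n^{-1/2} ∑ i, (δ_{x i} - P)`. -/
def empiricalProcess {X : Type*} [MeasurableSpace X] (P : Measure X) (S : Set (X → ℝ))
    (hb : ∀ x, Memℓp (fun s : S => s.1 x - ∫ y, s.1 y ∂P) ∞) (n : ℕ) (x : Fin n → X) :
    EllInf S :=
  (√(n : ℝ))⁻¹ • ∑ i : Fin n, (⟨fun s : S => s.1 (x i) - ∫ y, s.1 y ∂P, hb (x i)⟩ : EllInf S)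

/-- `S` is a `P`-Donsker class: a class of measurable square-integrable functions, with
`sup_{s ∈ S} |s x - P s| < ∞` for each `x`, whose empirical process, based on an i.i.d. sample
from `P`, converges in distribution in `ℓ^∞(S)` to a tight Borel law. -/
def IsDonsker {X : Type*} [MeasurableSpace X] (P : Measure X) (S : Set (X → ℝ)) : Prop :=
  (∀ s ∈ S, Measurable s ∧ MemLp s 2 P) ∧
  ∃ hb : ∀ x, Memℓp (fun s : S => s.1 x - ∫ y, s.1 y ∂P) ∞,
  ∃ L : @Measure (EllInf S) (borel (EllInf S)),
    @IsProbabilityMeasure _ (borel (EllInf S)) L ∧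
    (∀ ε : ℝ≥0∞, 0 < ε → ∃ C : Set (EllInf S), IsCompact C ∧ L Cᶜ ≤ ε) ∧
    @ConvergesInLaw (EllInf S) _ (borel (EllInf S)) (fun n => Fin n → X) _
      (fun n => Measure.pi fun _ : Fin n => P) (empiricalProcess P S hb) L

/-! ### Abstract density models

A (version of a) density is a function with values in `[0, ∞]`; a density which is
integrable is finite almost everywhere. -/

section Model

variable {X : Type*} [MeasurableSpace X]

/-- The chi divergence `χ(f, f₀) = ‖f / f₀ - 1‖_{L₂(f₀ dμ)}`, with values in `[0, ∞]`. -/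
def chi (μ : Measure X) (f f₀ : X → ℝ≥0∞) : ℝ≥0∞ :=
  eLpNorm (fun x => (f x / f₀ x).toReal - 1) 2 (μ.withDensity f₀)

/-- The chi-square divergence. -/
def chiSq (μ : Measure X) (f f₀ : X → ℝ≥0∞) : ℝ≥0∞ := chi μ f f₀ ^ 2

open Classical in
/-- The score `s_f = (f / f₀ - 1) / χ(f, f₀)`, set to `0` on the `f₀ dμ`-null set
where `f₀` is `0` or `∞`, so that the quotient `f / f₀` has no meaning. -/
def score (μ : Measure X) (f₀ f : X → ℝ≥0∞) (x : X) : ℝ :=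
  if f₀ x = 0 ∨ f₀ x = ∞ then 0 else ((f x / f₀ x).toReal - 1) / (chi μ f f₀).toReal

/-- The score set `{s_f : f ∈ F \ f₀}`. -/
def scoreSet (μ : Measure X) (F : Set (X → ℝ≥0∞)) (f₀ : X → ℝ≥0∞) : Set (X → ℝ) :=
  score μ f₀ '' (F \ {f₀})

/-- (A1): `χ²(f, f₀) ∈ (0, ∞)` for each `f ∈ F \ f₀`. -/
def AssumptionA1 (μ : Measure X) (F : Set (X → ℝ≥0∞)) (f₀ : X → ℝ≥0∞) : Prop :=
  ∀ f ∈ F \ {f₀}, 0 < chiSq μ f f₀ ∧ chiSq μ f f₀ < ∞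

/-- (A2): the score set is `f₀ dμ`-Donsker and has an `f₀ dμ`-square-integrable envelope. -/
def AssumptionA2 (μ : Measure X) (F : Set (X → ℝ≥0∞)) (f₀ : X → ℝ≥0∞) : Prop :=
  IsDonsker (μ.withDensity f₀) (scoreSet μ F f₀) ∧
  ∃ E : X → ℝ, MemLp E 2 (μ.withDensity f₀) ∧ ∀ s ∈ scoreSet μ F f₀, ∀ x, |s x| ≤ E x

/-- (SS): `(1 - t) f₀ + t f ∈ F` for all `f ∈ F` and `t ∈ [0, 1]`. -/
def AssumptionSS (F : Set (X → ℝ≥0∞)) (f₀ : X → ℝ≥0∞) : Prop :=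
  ∀ f ∈ F, ∀ t : ℝ, 0 ≤ t → t ≤ 1 →
    (fun x => ENNReal.ofReal (1 - t) * f₀ x + ENNReal.ofReal t * f x) ∈ F

/-- The log-likelihood `ℓ_n(f) = ∑_{i < n} log f(x_i)`, with `log 0 = -∞`. -/
def logLik (n : ℕ) (x : ℕ → X) (f : X → ℝ≥0∞) : EReal :=
  ∑ i ∈ Finset.range n, ENNReal.log (f (x i))

end Model

/-! ### Mixture models

The parameter space is a set `Θ ⊆ ℝ^d`; a mixing distribution is a probability measure
on the subtype `Θ`. -/

section Mixture

variable {d : ℕ} {Θ : Set (EuclideanSpace ℝ (Fin d))} {X : Type*} [MeasurableSpace X]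

/-- The mixture density `f_g(x) = ∫ p_θ(x) dg(θ)`. -/
def mixDensity (p : Θ → X → ℝ≥0) (g : Measure Θ) (x : X) : ℝ≥0∞ :=
  ∫⁻ θ, (p θ x : ℝ≥0∞) ∂g

/-- (ID): `Θ` is bounded, and for each probability measure `g` on `Θ`,
`χ²(f_g, f_{g₀}) = 0` if and only if `g = g₀`. -/
def AssumptionID (μ : Measure X) (p : Θ → X → ℝ≥0) (g₀ : Measure Θ) : Prop :=
  Bornology.IsBounded Θ ∧
  ∀ g : Measure Θ, IsProbabilityMeasure g →
    (chiSq μ (mixDensity p g) (mixDensity p g₀) = 0 ↔ g = g₀)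

/-- The value of a polynomial in `d` variables at a parameter. -/
def polyEval (r : MvPolynomial (Fin d) ℝ) (θ : Θ) : ℝ :=
  MvPolynomial.eval (fun i => (θ : EuclideanSpace ℝ (Fin d)) i) r

/-- `q₀, q₁, …` are polynomials with `q₀ ≡ 1` on `Θ` that are orthonormal in `L₂(g₀)`. -/
def IsOrthonormalPolySeq (g₀ : Measure Θ) (q : ℕ → MvPolynomial (Fin d) ℝ) : Prop :=
  (∀ θ : Θ, polyEval (q 0) θ = 1) ∧
  ∀ k l : ℕ, ∫ θ, polyEval (q k) θ * polyEval (q l) θ ∂g₀ = if k = l then 1 else 0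

/-- The multiplicative weight `1 + ∑_{k=1}^K c_k q_k(θ)`. -/
def weight (q : ℕ → MvPolynomial (Fin d) ℝ) {K : ℕ} (c : Fin K → ℝ) (θ : Θ) : ℝ :=
  1 + ∑ k : Fin K, c k * polyEval (q (k + 1)) θ

/-- The order-`K` submodel: probability measures `g` on `Θ` with
`dg = (1 + ∑_{k=1}^K c_k q_k) dg₀` for some `c ∈ ℝ^K`. -/
def submodel (g₀ : Measure Θ) (q : ℕ → MvPolynomial (Fin d) ℝ) (K : ℕ) : Set (Measure Θ) :=
  {g | IsProbabilityMeasure g ∧ ∃ c : Fin K → ℝ, (∀ᵐ θ ∂g₀, 0 ≤ weight q c θ) ∧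
    g = g₀.withDensity fun θ => ENNReal.ofReal (weight q c θ)}

/-- The corresponding class of mixture densities. -/
def submodelDensities (p : Θ → X → ℝ≥0) (g₀ : Measure Θ) (q : ℕ → MvPolynomial (Fin d) ℝ)
    (K : ℕ) : Set (X → ℝ≥0∞) :=
  mixDensity p '' submodel g₀ q K

/-- `g n` is, for each `n`, a (random) element of the class `G` such that
`sup_{γ ∈ G} ℓ_n(f_γ) - ℓ_n(f_{g n}) = o_P(1)`. The estimator need not be measurable,
so that the probability is an outer probability. -/
def IsApproxMLE {Ω : Type*} [MeasurableSpace Ω] (Pr : Measure Ω) (Y : ℕ → Ω → X)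
    (p : Θ → X → ℝ≥0) (G : Set (Measure Θ)) (g : ℕ → Ω → Measure Θ) : Prop :=
  (∀ n ω, g n ω ∈ G) ∧
  ∀ ε : ℝ, 0 < ε → Tendsto
    (fun n => Pr {ω | logLik n (fun i => Y i ω) (mixDensity p (g n ω)) + (ε : EReal) <
      ⨆ γ ∈ G, logLik n (fun i => Y i ω) (mixDensity p γ)}) atTop (𝓝 0)

end Mixture

/-- The chi-square law with `K` degrees of freedom: the law of the sum of squares of `K`
independent standard normal variables. -/
def chiSquareLaw (K : ℕ) : Measure ℝ :=
  (Measure.pi fun _ : Fin K => gaussianReal 0 1).map fun z => ∑ k, z k ^ 2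

end NPMixture

end

/-! Every `f_g` in the submodel is `f₀ (1 + ∑ c_k S_k)` where `0 < f₀ < ∞`, with `S_k = (∫ p_θ q_k
dg₀) / f₀`. Each `S_k(x)` is an average of `q_k` with weights proportional to `p_θ(x) dg₀`, so
boundedness of `Θ` makes it bounded. Orthogonality of `q_k` to `q₀ = 1` gives it mean zero under `f₀
dμ`. The `S_k` are linearly independent in `L₂(f₀ dμ)`: a vanishing combination, scaled down, would
give some `g ≠ g₀` with `χ² = 0`, against (ID).

Orthonormalising the `S_k` gives a bounded vector `e` with mean zero and identity covariance. In
these coordinates `f_g = f₀ (1 + ⟪b, e⟫)` and `χ(f_g, f₀) = ‖b‖`; the admissible `b` include a ball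
around `0` (`exists_isWhite`). The model has become a `K`-dimensional linear one with the true
parameter in the interior.

Scores are now `⟪b / ‖b‖, e⟫`, so the empirical process over the score set is a fixed continuous
linear image of `Z_n = n^{-1/2} ∑ e(X_i)`. The Donsker property is the multivariate central limit
theorem followed by a continuous map (`IsWhite.isDonsker`).

The log-likelihood ratio `∑ log (1 + ⟪b, e(X_i)⟫)` is concave in `b`, and at `b = β / √n` it is `⟪β,
Z_n⟫ - ‖β‖² / 2 + o_P(1)` uniformly over bounded `β`. The quadratic is maximal at `β = Z_n`, and
`Z_n / √n` is eventually admissible with high probability. Concavity excludes near-maximisers away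
from `Z_n` (`norm_sub_le_of_approx_max`), so no separate consistency proof is needed. Hence `n χ²`
and twice the log-likelihood ratio are both `‖Z_n‖² + o_P(1)`, with the chi-square limit. The
estimator enters only through its distance to the measurable `‖Z_n‖²`, so outer probabilities
suffice (`convergesInLaw_map_of_close`). -/

namespace NPMixture

/-! ### Outer expectations and perturbations of weakly convergent sequences -/

section OuterExpectation

variable {Ω : Type*} [MeasurableSpace Ω] {Q : Measure Ω} [IsProbabilityMeasure Q]

/-- Off a measurable hull of `A` the two maps differ by at most `δ`, and on it by at most `2 * C`.
The lower bound holds for every measurable majorant of `T`; the upper bound needs one good majorant.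
-/
theorem abs_outerExpectation_sub_integral_le {T T' : Ω → ℝ} {C δ : ℝ} (A : Set Ω)
    (hT' : AEMeasurable T' Q) (hC : ∀ ω, |T ω| ≤ C) (hC' : ∀ ω, |T' ω| ≤ C) (hδ : 0 ≤ δ)
    (h : ∀ ω ∉ A, |T ω - T' ω| ≤ δ) :
    |outerExpectation Q T - ∫ ω, T' ω ∂Q| ≤ δ + 2 * C * Q.real A := by
  classical
  set N : Set Ω := {ω | T' ω ≠ hT'.mk T' ω} with hN
  have hN0 : Q N = 0 := hT'.ae_eq_mk
  -- The hull has the outer measure of `A`. It also absorbs the null set where `T'` differs from its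
  -- measurable version, because a majorant has to dominate at every point.
  set B : Set Ω := toMeasurable Q (A ∪ N) with hB
  have hBm : MeasurableSet B := measurableSet_toMeasurable _ _
  have hAB : A ∪ N ⊆ B := subset_toMeasurable _ _
  have hQB : Q.real B = Q.real A := by
    simp only [measureReal_def, hB, measure_toMeasurable]
    rw [measure_congr (union_ae_eq_left_of_ae_eq_empty (ae_eq_empty.2 hN0))]
  have hC0 : 0 ≤ C := by
    obtain ⟨ω⟩ : Nonempty Ω := by
      by_contra hne
      rw [not_nonempty_iff] at hne
      have := measure_univ (μ := Q)
      simp [Set.univ_eq_empty_iff.2 hne] at this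
    exact (abs_nonneg _).trans (hC ω)
  have hT'i : Integrable T' Q :=
    Integrable.of_bound hT'.aestronglyMeasurable C (ae_of_all _ fun ω => hC' ω)
  have hind : Integrable (B.indicator fun _ => (2 * C : ℝ)) Q :=
    (integrable_const _).indicator hBm
  have hindI : ∫ ω, B.indicator (fun _ => (2 * C : ℝ)) ω ∂Q = 2 * C * Q.real A := by
    rw [integral_indicator hBm, setIntegral_const, hQB, smul_eq_mul, mul_comm]
  have hG : Integrable (fun ω => δ + B.indicator (fun _ => (2 * C : ℝ)) ω) Q :=
    (integrable_const _).add hind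
  have hGI : ∫ ω, (δ + B.indicator (fun _ => (2 * C : ℝ)) ω) ∂Q = δ + 2 * C * Q.real A := by
    rw [integral_add (integrable_const _) hind, hindI]
    simp
  have hoff : ∀ ω ∉ B, |T ω - T' ω| ≤ δ ∧ T' ω = hT'.mk T' ω := by
    intro ω hω
    refine ⟨h ω fun hA => hω (hAB (Or.inl hA)), ?_⟩
    by_contra hne
    exact hω (hAB (Or.inr hne))
  have hlow : ∀ U : Ω → ℝ, Integrable U Q → (∀ ω, T ω ≤ U ω) →
      ∫ ω, T' ω ∂Q - (δ + 2 * C * Q.real A) ≤ ∫ ω, U ω ∂Q := by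
    intro U hU hTU
    have : ∫ ω, T' ω - (δ + B.indicator (fun _ => (2 * C : ℝ)) ω) ∂Q ≤ ∫ ω, U ω ∂Q := by
      refine integral_mono (hT'i.sub hG) hU fun ω => ?_
      have h1 := abs_le.1 (hC ω)
      have h2 := abs_le.1 (hC' ω)
      refine le_trans ?_ (hTU ω)
      by_cases hω : ω ∈ B
      · simp only [Set.indicator_of_mem hω]; linarith
      · have h3 := abs_le.1 (hoff ω hω).1
        simp only [Set.indicator_of_notMem hω]; linarith
    have e : ∫ ω, T' ω - (δ + B.indicator (fun _ => (2 * C : ℝ)) ω) ∂Q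
        = ∫ ω, T' ω ∂Q - (δ + 2 * C * Q.real A) := by
      rw [integral_sub hT'i hG, hGI]
    linarith
  set U₀ : Ω → ℝ := B.piecewise (fun _ => C) (fun ω => hT'.mk T' ω + δ) with hU₀
  have hU₀m : Measurable U₀ :=
    Measurable.piecewise hBm measurable_const (hT'.measurable_mk.add_const _)
  have hU₀b : ∀ ω, |U₀ ω| ≤ C + δ := by
    intro ω
    by_cases hω : ω ∈ B
    · simp only [hU₀, Set.piecewise_eq_of_mem _ _ _ hω, abs_of_nonneg hC0]; linarith
    · simp only [hU₀, Set.piecewise_eq_of_notMem _ _ _ hω, ← (hoff ω hω).2]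
      have h2 := abs_le.1 (hC' ω)
      exact abs_le.2 ⟨by linarith, by linarith⟩
  have hU₀i : Integrable U₀ Q :=
    Integrable.of_bound hU₀m.aestronglyMeasurable (C + δ) (ae_of_all _ fun ω => hU₀b ω)
  have hTU₀ : ∀ ω, T ω ≤ U₀ ω := by
    intro ω
    by_cases hω : ω ∈ B
    · simp only [hU₀, Set.piecewise_eq_of_mem _ _ _ hω]; exact (abs_le.1 (hC ω)).2
    · simp only [hU₀, Set.piecewise_eq_of_notMem _ _ _ hω, ← (hoff ω hω).2]
      linarith [(abs_le.1 (hoff ω hω).1).2]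
  have hup : ∫ ω, U₀ ω ∂Q ≤ ∫ ω, T' ω ∂Q + (δ + 2 * C * Q.real A) := by
    have : ∫ ω, U₀ ω ∂Q ≤ ∫ ω, T' ω + (δ + B.indicator (fun _ => (2 * C : ℝ)) ω) ∂Q := by
      refine integral_mono hU₀i (hT'i.add hG) fun ω => ?_
      have h2 := abs_le.1 (hC' ω)
      by_cases hω : ω ∈ B
      · simp only [hU₀, Set.piecewise_eq_of_mem _ _ _ hω, Set.indicator_of_mem hω]; linarith
      · simp only [hU₀, Set.piecewise_eq_of_notMem _ _ _ hω, ← (hoff ω hω).2,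
          Set.indicator_of_notMem hω]
        linarith
    rwa [integral_add hT'i hG, hGI] at this
  have hmem : ∫ ω, U₀ ω ∂Q ∈ {r : ℝ | ∃ U : Ω → ℝ, Measurable U ∧ Integrable U Q ∧
      (∀ ω, T ω ≤ U ω) ∧ ∫ ω, U ω ∂Q = r} := ⟨U₀, hU₀m, hU₀i, hTU₀, rfl⟩
  have hbdd : ∀ r ∈ {r : ℝ | ∃ U : Ω → ℝ, Measurable U ∧ Integrable U Q ∧
      (∀ ω, T ω ≤ U ω) ∧ ∫ ω, U ω ∂Q = r},
      ∫ ω, T' ω ∂Q - (δ + 2 * C * Q.real A) ≤ r := by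
    rintro r ⟨U, -, hU, hTU, rfl⟩
    exact hlow U hU hTU
  have h1 := le_csInf ⟨_, hmem⟩ hbdd
  have h2 := csInf_le ⟨_, hbdd⟩ hmem
  rw [abs_le]
  unfold outerExpectation
  constructor <;> linarith

theorem outerExpectation_eq_integral {T : Ω → ℝ} {C : ℝ} (hT : AEMeasurable T Q)
    (hC : ∀ ω, |T ω| ≤ C) : outerExpectation Q T = ∫ ω, T ω ∂Q := by
  have := abs_outerExpectation_sub_integral_le (Q := Q) ∅ hT hC hC le_rfl (by simp)
  simp only [measureReal_empty, mul_zero, add_zero] at this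
  exact sub_eq_zero.1 (abs_nonpos_iff.1 this)

/-- The continuous cutoff `w ↦ min 1 (max 0 (|w| - R))`. -/
noncomputable def tailCutoff (R : ℝ) : ℝ →ᵇ ℝ :=
  BoundedContinuousFunction.ofNormedAddCommGroup (fun w => min 1 (max 0 (|w| - R)))
    (by fun_prop) 1 fun w => by
      rw [Real.norm_eq_abs, abs_le]
      exact ⟨by linarith [le_min zero_le_one (le_max_left 0 (|w| - R))], min_le_left _ _⟩

theorem tailCutoff_apply (R w : ℝ) : tailCutoff R w = min 1 (max 0 (|w| - R)) := rfl

theorem tendsto_integral_tailCutoff (L : Measure ℝ) [IsProbabilityMeasure L] :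
    Tendsto (fun n : ℕ => ∫ w, tailCutoff n w ∂L) atTop (𝓝 0) := by
  rw [← integral_zero ℝ ℝ (μ := L)]
  refine tendsto_integral_of_dominated_convergence (fun _ => 1)
    (fun n => (tailCutoff n).continuous.aestronglyMeasurable) (integrable_const _) ?_ ?_
  · refine fun n => ae_of_all _ fun w => ?_
    rw [tailCutoff_apply, Real.norm_eq_abs, abs_le]
    exact ⟨by linarith [le_min zero_le_one (le_max_left 0 (|w| - n))], min_le_left _ _⟩
  · refine ae_of_all _ fun w => ?_
    refine tendsto_const_nhds.congr' ?_
    filter_upwards [eventually_ge_atTop ⌈|w|⌉₊] with n hn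
    have : |w| - n ≤ 0 := by linarith [Nat.ceil_le.1 hn]
    rw [tailCutoff_apply, max_eq_left this]
    simp

/-- Weakly convergent real random variables are asymptotically tight. -/
theorem exists_eventually_measureReal_abs_gt_le {W : ℕ → Ω → ℝ}
    (hW : ∀ n, AEMeasurable (W n) Q) {L : Measure ℝ} [IsProbabilityMeasure L]
    (hWL : ∀ h : ℝ →ᵇ ℝ, Tendsto (fun n => ∫ ω, h (W n ω) ∂Q) atTop (𝓝 (∫ z, h z ∂L)))
    {ε : ℝ} (hε : 0 < ε) : ∃ R : ℝ, ∀ᶠ n in atTop, Q.real {ω | R < |W n ω|} ≤ ε := by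
  obtain ⟨k, hk⟩ := ((tendsto_integral_tailCutoff L).eventually_lt_const hε).exists
  refine ⟨k + 1, ?_⟩
  filter_upwards [(hWL (tailCutoff k)).eventually_lt_const hk] with n hn
  refine le_trans ?_ hn.le
  have hm : NullMeasurableSet {ω | (k : ℝ) + 1 < |W n ω|} Q :=
    nullMeasurableSet_lt aemeasurable_const (hW n).abs
  have hi : Integrable (fun ω => tailCutoff k (W n ω)) Q :=
    Integrable.of_bound
      ((tailCutoff k).continuous.measurable.comp_aemeasurable (hW n)).aestronglyMeasurable
      ‖tailCutoff k‖ (ae_of_all _ fun ω => (tailCutoff k).norm_coe_le_norm _)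
  have : ∫ ω, {ω | (k : ℝ) + 1 < |W n ω|}.indicator (fun _ => (1 : ℝ)) ω ∂Q
      = Q.real {ω | (k : ℝ) + 1 < |W n ω|} := by
    rw [integral_indicator₀ hm, setIntegral_const, smul_eq_mul, mul_one]
  rw [← this]
  refine integral_mono ((integrable_const _).indicator₀ hm) hi fun ω => ?_
  by_cases hω : (k : ℝ) + 1 < |W n ω|
  · rw [Set.indicator_of_mem (by exact hω)]
    rw [tailCutoff_apply]
    exact le_min le_rfl (le_max_of_le_right (by linarith))
  · rw [Set.indicator_of_notMem (by exact hω)]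
    rw [tailCutoff_apply]
    exact le_min zero_le_one (le_max_left _ _)

/-- If `W n` converges weakly to `L` and `Z n` is, with high probability, close to `W n` via the
continuous map `φ`, then `Z n` converges in law to the image of `L`. -/
theorem convergesInLaw_map_of_close {D : Type*} [TopologicalSpace D] [MeasurableSpace D]
    [BorelSpace D] {φ : ℝ → D} (hφ : Continuous φ) {Z : ℕ → Ω → D} {W : ℕ → Ω → ℝ}
    (hW : ∀ n, AEMeasurable (W n) Q) {L : Measure ℝ} [IsProbabilityMeasure L]
    (hWL : ∀ h : ℝ →ᵇ ℝ, Tendsto (fun n => ∫ ω, h (W n ω) ∂Q) atTop (𝓝 (∫ z, h z ∂L)))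
    (hclose : ∀ R δ : ℝ, 0 < δ → Tendsto
      (fun n => Q {ω | |W n ω| ≤ R ∧ ¬ ∃ z, Z n ω = φ z ∧ |z - W n ω| ≤ δ}) atTop (𝓝 0)) :
    ConvergesInLaw (fun _ => Q) Z (L.map φ) := by
  intro h
  set k : ℝ →ᵇ ℝ := h.compContinuous ⟨φ, hφ⟩ with hk
  have hkφ : ∀ z, k z = h (φ z) := fun z => rfl
  have hlim : ∫ z, h z ∂(L.map φ) = ∫ z, k z ∂L := by
    rw [integral_map hφ.measurable.aemeasurable]
    · rfl
    · exact h.continuous.measurable.stronglyMeasurable.aestronglyMeasurable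
  rw [hlim]
  suffices hs : Tendsto (fun n => outerExpectation Q (fun ω => h (Z n ω)) - ∫ ω, k (W n ω) ∂Q)
      atTop (𝓝 0) by
    simpa using hs.add (hWL k)
  rw [Metric.tendsto_nhds]
  intro ε hε
  set C : ℝ := ‖h‖ with hC
  have hC0 : 0 ≤ C := norm_nonneg _
  -- Two bad events of this size, weighted by `2 * C`, cost at most `ε / 2`; the modulus of
  -- continuity costs another `ε / 4`.
  obtain ⟨R, hR⟩ := exists_eventually_measureReal_abs_gt_le hW hWL
    (ε := ε / (4 * (2 * C + 1))) (by positivity)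
  -- The extra unit leaves room for `z`, which is kept within distance `1` of `W n ω`.
  have hu : UniformContinuousOn k (Set.Icc (-(R + 1)) (R + 1)) :=
    isCompact_Icc.uniformContinuousOn_of_continuous k.continuous.continuousOn
  obtain ⟨δ, hδ, hδk⟩ := Metric.uniformContinuousOn_iff_le.1 hu (ε / 4) (by positivity)
  have hbad := hclose R (min δ 1) (by positivity)
  have hbad' : Tendsto (fun n => Q.real {ω | |W n ω| ≤ R ∧
      ¬ ∃ z, Z n ω = φ z ∧ |z - W n ω| ≤ min δ 1}) atTop (𝓝 0) := by
    exact (ENNReal.tendsto_toReal ENNReal.zero_ne_top).comp hbad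
  filter_upwards [hR, hbad'.eventually_lt_const
    (show (0 : ℝ) < ε / (4 * (2 * C + 1)) by positivity)] with n hn1 hn2
  have key := abs_outerExpectation_sub_integral_le (Q := Q) (T := fun ω => h (Z n ω))
    (T' := fun ω => k (W n ω)) (C := C) (δ := ε / 4)
    ({ω | R < |W n ω|} ∪ {ω | |W n ω| ≤ R ∧ ¬ ∃ z, Z n ω = φ z ∧ |z - W n ω| ≤ min δ 1})
    (k.continuous.measurable.comp_aemeasurable (hW n)) (fun ω => h.norm_coe_le_norm _)
    (fun ω => h.norm_coe_le_norm _) (by positivity) (by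
      intro ω hω
      simp only [Set.mem_union, Set.mem_ofPred_eq, not_or, not_lt, not_and, not_not] at hω
      obtain ⟨hω1, hω2⟩ := hω
      obtain ⟨z, hz1, hz2⟩ := hω2 hω1
      have hW' := abs_le.1 hω1
      have hz3 := abs_le.1 (hz2.trans (min_le_right _ _))
      rw [hz1, ← hkφ]
      exact hδk z ⟨by linarith, by linarith⟩ (W n ω) ⟨by linarith, by linarith⟩
        (hz2.trans (min_le_left _ _)))
  rw [Real.dist_eq, sub_zero]
  refine key.trans_lt ?_
  have hunion := measureReal_union_le (μ := Q) {ω | R < |W n ω|}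
    {ω | |W n ω| ≤ R ∧ ¬ ∃ z, Z n ω = φ z ∧ |z - W n ω| ≤ min δ 1}
  have h3 : 2 * C * (ε / (4 * (2 * C + 1)) + ε / (4 * (2 * C + 1))) ≤ ε / 2 := by
    have : 2 * C * (ε / (4 * (2 * C + 1)) + ε / (4 * (2 * C + 1)))
        = (2 * C / (2 * C + 1)) * (ε / 2) := by field_simp; ring
    rw [this]
    have h4 : 2 * C / (2 * C + 1) ≤ 1 := by rw [div_le_one (by positivity)]; linarith
    nlinarith
  have h5 : 2 * C * Q.real ({ω | R < |W n ω|} ∪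
      {ω | |W n ω| ≤ R ∧ ¬ ∃ z, Z n ω = φ z ∧ |z - W n ω| ≤ min δ 1})
      ≤ 2 * C * (ε / (4 * (2 * C + 1)) + ε / (4 * (2 * C + 1))) :=
    mul_le_mul_of_nonneg_left (hunion.trans (add_le_add hn1 hn2.le)) (by positivity)
  linarith

end OuterExpectation

/-! ### Whitened bounded scores and their central limit theorem -/

/-- `e` is a bounded measurable random vector with mean zero and identity covariance under `P`. -/
structure IsWhite {X : Type*} [MeasurableSpace X] {K : ℕ} (P : Measure X)
    (e : X → EuclideanSpace ℝ (Fin K)) (M : ℝ) : Prop where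
  measurable : Measurable e
  norm_le : ∀ x, ‖e x‖ ≤ M
  mean : ∀ t, ∫ x, inner ℝ t (e x) ∂P = 0
  cov : ∀ s t, ∫ x, inner ℝ s (e x) * inner ℝ t (e x) ∂P = inner ℝ s t

section Limit

variable {X : Type*} [MeasurableSpace X] {K : ℕ} {P : Measure X}
  {e : X → EuclideanSpace ℝ (Fin K)} {M : ℝ}

/-- The normalised sum `n^{-1/2} ∑ i, e (x i)`. -/
noncomputable def normSum (e : X → EuclideanSpace ℝ (Fin K)) (n : ℕ) (x : Fin n → X) :
    EuclideanSpace ℝ (Fin K) :=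
  (√(n : ℝ))⁻¹ • ∑ i, e (x i)

theorem measurable_normSum (he : Measurable e) (n : ℕ) : Measurable (normSum e n) := by
  unfold normSum
  fun_prop

theorem charFun_map_normSum [IsProbabilityMeasure P] (he : Measurable e) (n : ℕ)
    (t : EuclideanSpace ℝ (Fin K)) :
    charFun ((Measure.pi fun _ : Fin n => P).map (normSum e n)) t =
      (∫ x, Complex.exp ((((√(n : ℝ))⁻¹ * inner ℝ (e x) t : ℝ) : ℂ) * Complex.I) ∂P) ^ n := by
  rw [charFun_apply, integral_map (measurable_normSum he n).aemeasurable (by fun_prop)]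
  have := integral_fintype_prod_eq_prod (μ := fun _ : Fin n => P)
    (f := fun (_ : Fin n) (x : X) =>
      Complex.exp ((((√(n : ℝ))⁻¹ * inner ℝ (e x) t : ℝ) : ℂ) * Complex.I))
  simp only [Finset.prod_const, Finset.card_univ, Fintype.card_fin] at this
  rw [← this]
  congr 1 with x
  rw [← Complex.exp_sum, normSum, real_inner_smul_left, sum_inner, ← Finset.sum_mul, Finset.mul_sum]
  push_cast
  rfl

/-- Cramér–Wold: for `t ≠ 0` the projection of `e` on `t / ‖t‖` has mean zero and variance one, and
the scalar central limit theorem is read off at the argument `‖t‖`. -/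
theorem IsWhite.tendsto_charFun [IsProbabilityMeasure P] (he : IsWhite P e M)
    (t : EuclideanSpace ℝ (Fin K)) :
    Tendsto (fun n : ℕ => charFun ((Measure.pi fun _ : Fin n => P).map (normSum e n)) t) atTop
      (𝓝 (charFun (stdGaussian (EuclideanSpace ℝ (Fin K))) t)) := by
  simp_rw [charFun_map_normSum he.measurable, charFun_stdGaussian]
  rcases eq_or_ne t 0 with rfl | ht
  · simp
  have ht' : ‖t‖ ≠ 0 := norm_ne_zero_iff.2 ht
  have hm : Measurable fun x => inner ℝ (‖t‖⁻¹ • t) (e x) :=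
    Measurable.inner measurable_const he.measurable
  have key := tendsto_charFun_inv_sqrt_mul_pow (P := P)
    (X := fun x => inner ℝ (‖t‖⁻¹ • t) (e x)) hm.aemeasurable (he.mean _) (by
      have := he.cov (‖t‖⁻¹ • t) (‖t‖⁻¹ • t)
      simp only [Pi.pow_apply, pow_two]
      rw [this, real_inner_smul_left, real_inner_smul_right, real_inner_self_eq_norm_sq]
      field_simp) ‖t‖
  refine (key.congr fun n => ?_)
  rw [charFun_apply_real, integral_map hm.aemeasurable (by fun_prop)]
  congr 2 with x
  rw [real_inner_smul_left, real_inner_comm]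
  congr 2
  push_cast
  have : (‖t‖ : ℂ) ≠ 0 := by exact_mod_cast ht'
  field_simp

/-- The multivariate central limit theorem for whitened vectors. -/
theorem IsWhite.tendsto_integral_normSum [IsProbabilityMeasure P] (he : IsWhite P e M)
    (h : EuclideanSpace ℝ (Fin K) →ᵇ ℝ) :
    Tendsto (fun n : ℕ => ∫ x, h (normSum e n x) ∂(Measure.pi fun _ : Fin n => P)) atTop
      (𝓝 (∫ z, h z ∂(stdGaussian (EuclideanSpace ℝ (Fin K))))) := by
  have hprob : ∀ n : ℕ, IsProbabilityMeasure
      ((Measure.pi fun _ : Fin n => P).map (normSum e n)) := fun n =>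
    Measure.isProbabilityMeasure_map (measurable_normSum he.measurable n).aemeasurable
  have key := ProbabilityMeasure.tendsto_of_tendsto_charFun
    (μ := fun n => ⟨_, hprob n⟩)
    (μ₀ := ⟨stdGaussian (EuclideanSpace ℝ (Fin K)), inferInstance⟩) he.tendsto_charFun
  refine (ProbabilityMeasure.tendsto_iff_forall_integral_tendsto.1 key h).congr fun n => ?_
  simp only [ProbabilityMeasure.coe_mk]
  rw [integral_map (measurable_normSum he.measurable n).aemeasurable
    h.continuous.measurable.aestronglyMeasurable]

variable {Ω : Type*} [MeasurableSpace Ω] {Pr : Measure Ω}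
  {Y : ℕ → Ω → X}

theorem hasLaw_fin_of_iIndepFun (hY : ∀ i, HasLaw (Y i) P Pr) (hind : iIndepFun Y Pr) (n : ℕ) :
    HasLaw (fun ω (i : Fin n) => Y i ω) (Measure.pi fun _ : Fin n => P) Pr :=
  iIndepFun.hasLaw_pi (X := fun (i : Fin n) => Y i) (fun i => hY i)
    (hind.precomp Fin.val_injective)

theorem IsWhite.tendsto_integral_sample [IsProbabilityMeasure P] (he : IsWhite P e M)
    (hY : ∀ i, HasLaw (Y i) P Pr) (hind : iIndepFun Y Pr) (h : EuclideanSpace ℝ (Fin K) →ᵇ ℝ) :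
    Tendsto (fun n : ℕ => ∫ ω, h (normSum e n fun i => Y i ω) ∂Pr) atTop
      (𝓝 (∫ z, h z ∂(stdGaussian (EuclideanSpace ℝ (Fin K))))) := by
  refine (he.tendsto_integral_normSum h).congr fun n => ?_
  rw [← (hasLaw_fin_of_iIndepFun hY hind n).map_eq,
    integral_map (hasLaw_fin_of_iIndepFun hY hind n).aemeasurable]
  exact (h.continuous.measurable.comp
    (measurable_normSum he.measurable n)).aestronglyMeasurable

/-- The total deviation of the empirical covariance matrix of `e` from the identity. -/
noncomputable def covDev (e : X → EuclideanSpace ℝ (Fin K)) (n : ℕ) (y : ℕ → X) : ℝ :=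
  ∑ j, ∑ l, |(∑ i ∈ Finset.range n, e (y i) j * e (y i) l) / n - if j = l then 1 else 0|

theorem IsWhite.integral_coord_mul (he : IsWhite P e M) (j l : Fin K) :
    ∫ x, e x j * e x l ∂P = if j = l then 1 else 0 := by
  have := he.cov (EuclideanSpace.single j 1) (EuclideanSpace.single l 1)
  simpa [EuclideanSpace.inner_single_left, eq_comm] using this

theorem IsWhite.abs_coord_le (he : IsWhite P e M) (j : Fin K) (x : X) : |e x j| ≤ M :=
  (PiLp.norm_apply_le (e x) j).trans (he.norm_le x)

theorem IsWhite.tendsto_covDev [IsProbabilityMeasure P] (he : IsWhite P e M)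
    (hY : ∀ i, HasLaw (Y i) P Pr) (hind : iIndepFun Y Pr) :
    ∀ᵐ ω ∂Pr, Tendsto (fun n => covDev e n fun i => Y i ω) atTop (𝓝 0) := by
  have := hind.isProbabilityMeasure
  have h1 : ∀ j l, ∀ᵐ ω ∂Pr, Tendsto
      (fun n : ℕ => (∑ i ∈ Finset.range n, e (Y i ω) j * e (Y i ω) l) / n) atTop
      (𝓝 (if j = l then 1 else 0)) := by
    intro j l
    have hm : Measurable fun x => e x j * e x l := by
      have := he.measurable
      fun_prop
    have hid : ∀ i, IdentDistrib (fun ω => e (Y i ω) j * e (Y i ω) l)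
        (fun ω => e (Y 0 ω) j * e (Y 0 ω) l) Pr Pr := fun i =>
      IdentDistrib.comp (u := fun x => e x j * e x l)
        ⟨(hY i).aemeasurable, (hY 0).aemeasurable, by rw [(hY i).map_eq, (hY 0).map_eq]⟩ hm
    have := strong_law_ae_real (μ := Pr) (fun i ω => e (Y i ω) j * e (Y i ω) l)
      (by
        refine Integrable.of_bound (hid 0).aemeasurable_fst.aestronglyMeasurable (M * M)
          (ae_of_all _ fun ω => ?_)
        rw [norm_mul]
        exact mul_le_mul (he.abs_coord_le _ _) (he.abs_coord_le _ _) (norm_nonneg _)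
          ((abs_nonneg _).trans (he.abs_coord_le j (Y 0 ω))))
      (fun a b hab => (hind.indepFun hab).comp hm hm) hid
    have hI : ∫ ω, e (Y 0 ω) j * e (Y 0 ω) l ∂Pr = if j = l then 1 else 0 := by
      rw [← he.integral_coord_mul, ← (hY 0).map_eq,
        integral_map (hY 0).aemeasurable hm.aestronglyMeasurable]
    rwa [hI] at this
  filter_upwards [ae_all_iff.2 fun j => ae_all_iff.2 (h1 j)] with ω hω
  unfold covDev
  have : Tendsto (fun n : ℕ => ∑ j, ∑ l, |(∑ i ∈ Finset.range n, e (Y i ω) j * e (Y i ω) l) / n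
      - if j = l then 1 else 0|) atTop (𝓝 (∑ j : Fin K, ∑ l : Fin K, 0)) := by
    refine tendsto_finsetSum _ fun j _ => tendsto_finsetSum _ fun l _ => ?_
    have := ((hω j l).sub_const (if j = l then (1 : ℝ) else 0)).abs
    simpa using this
  simpa using this

end Limit

/-! ### Concave maximisation near a quadratic -/

/-- The left side is `n` times the quadratic form of (empirical covariance minus identity) at `β`,
and `|β j| ≤ ‖β‖` bounds it entrywise. One random quantity thus controls all `β` at once. -/
theorem abs_sum_inner_sq_sub_le {X : Type*} {K : ℕ} (e : X → EuclideanSpace ℝ (Fin K)) {n : ℕ}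
    (hn : n ≠ 0) (y : ℕ → X) (β : EuclideanSpace ℝ (Fin K)) :
    |∑ i ∈ Finset.range n, (inner ℝ β (e (y i))) ^ 2 - n * ‖β‖ ^ 2| ≤
      n * ‖β‖ ^ 2 * covDev e n y := by
  have hn' : (n : ℝ) ≠ 0 := Nat.cast_ne_zero.2 hn
  have hin : ∀ v : EuclideanSpace ℝ (Fin K), inner ℝ β v = ∑ j, β j * v j := fun v => by
    simp [PiLp.inner_apply, mul_comm]
  have h1 : ∑ i ∈ Finset.range n, (inner ℝ β (e (y i))) ^ 2 - n * ‖β‖ ^ 2 =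
      n * ∑ j, ∑ l, β j * β l * ((∑ i ∈ Finset.range n, e (y i) j * e (y i) l) / n -
        if j = l then 1 else 0) := by
    have a1 : ∑ i ∈ Finset.range n, (inner ℝ β (e (y i))) ^ 2 =
        ∑ j, ∑ l, β j * β l * ∑ i ∈ Finset.range n, e (y i) j * e (y i) l := by
      simp_rw [hin, pow_two, Finset.sum_mul_sum, Finset.mul_sum]
      rw [Finset.sum_comm]
      refine Finset.sum_congr rfl fun j _ => ?_
      rw [Finset.sum_comm]
      refine Finset.sum_congr rfl fun l _ => Finset.sum_congr rfl fun i _ => ?_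
      ring
    have a2 : ‖β‖ ^ 2 = ∑ j, ∑ l, β j * β l * (if j = l then 1 else 0) := by
      rw [EuclideanSpace.real_norm_sq_eq]
      simp [pow_two]
    rw [a1, a2, Finset.mul_sum, Finset.mul_sum, ← Finset.sum_sub_distrib]
    refine Finset.sum_congr rfl fun j _ => ?_
    rw [Finset.mul_sum, Finset.mul_sum, ← Finset.sum_sub_distrib]
    refine Finset.sum_congr rfl fun l _ => ?_
    field_simp
  rw [h1, abs_mul, Nat.abs_cast, mul_assoc]
  refine mul_le_mul_of_nonneg_left ?_ (Nat.cast_nonneg _)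
  unfold covDev
  rw [Finset.mul_sum]
  refine (Finset.abs_sum_le_sum_abs _ _).trans (Finset.sum_le_sum fun j _ => ?_)
  rw [Finset.mul_sum]
  refine (Finset.abs_sum_le_sum_abs _ _).trans (Finset.sum_le_sum fun l _ => ?_)
  rw [abs_mul]
  refine mul_le_mul_of_nonneg_right ?_ (abs_nonneg _)
  rw [abs_mul, pow_two]
  exact mul_le_mul (PiLp.norm_apply_le β j) (PiLp.norm_apply_le β l) (abs_nonneg _) (norm_nonneg _)

/-- Cutting the series of `log (1 - x)` at `x = -u` after two terms leaves at most `|u|³ / (1 -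
|u|)`. -/
theorem abs_log_one_add_sub_le {u : ℝ} (hu : |u| ≤ 1 / 2) :
    |Real.log (1 + u) - (u - u ^ 2 / 2)| ≤ 2 * |u| ^ 3 := by
  have h := Real.abs_log_sub_add_sum_range_le (x := -u) (by rw [abs_neg]; linarith) 2
  rw [abs_neg] at h
  have e1 : (∑ i ∈ Finset.range 2, (-u) ^ (i + 1) / ((i : ℝ) + 1)) + Real.log (1 - -u) =
      Real.log (1 + u) - (u - u ^ 2 / 2) := by
    simp [Finset.sum_range_succ]
    ring
  rw [e1] at h
  refine h.trans ?_
  rw [div_le_iff₀ (by linarith)]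
  have : 0 ≤ |u| ^ 3 := by positivity
  norm_num
  nlinarith

/-- A near-maximiser of a concave log-likelihood that is nearly quadratic on a ball is close to the
maximiser of the quadratic. -/
theorem norm_sub_le_of_approx_max {E ι : Type*} [NormedAddCommGroup E] [InnerProductSpace ℝ E]
    (s : Finset ι) (x : ι → E) {Z β : E} {R η ε ρ : ℝ} (hρ : 0 < ρ) (hρ1 : ρ ≤ 1)
    (hZ : ‖Z‖ ≤ R)
    (hpos : ∀ b, ‖b‖ ≤ R + 1 → ∀ i ∈ s, 0 < 1 + inner ℝ b (x i))
    (hquad : ∀ b, ‖b‖ ≤ R + 1 →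
      |∑ i ∈ s, Real.log (1 + inner ℝ b (x i)) - (inner ℝ b Z - ‖b‖ ^ 2 / 2)| ≤ η)
    (hβ : ∀ i ∈ s, 0 < 1 + inner ℝ β (x i))
    (hmax : ∑ i ∈ s, Real.log (1 + inner ℝ Z (x i)) ≤
      ∑ i ∈ s, Real.log (1 + inner ℝ β (x i)) + ε) (hε : 0 ≤ ε)
    (hsmall : 4 * η + 2 * ε < ρ ^ 2) : ‖β - Z‖ ≤ ρ := by
  by_contra! hlt
  -- `b` is the point of the segment from `Z` to `β` at distance exactly `ρ` from `Z`. As `ρ ≤ 1`,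
  -- it lies where the quadratic approximation is valid, however far away `β` is.
  set t : ℝ := ρ / ‖β - Z‖ with ht
  have hpos' : 0 < ‖β - Z‖ := hρ.trans hlt
  have ht0 : 0 ≤ t := by positivity
  have ht1 : t ≤ 1 := (div_le_one hpos').2 hlt.le
  set b : E := Z + t • (β - Z) with hb
  have hbZ : ‖b - Z‖ = ρ := by
    rw [hb, add_sub_cancel_left, norm_smul, Real.norm_of_nonneg ht0, ht,
      div_mul_cancel₀ _ hpos'.ne']
  have hbR : ‖b‖ ≤ R + 1 := by
    calc ‖b‖ = ‖Z + (b - Z)‖ := by rw [add_sub_cancel]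
      _ ≤ ‖Z‖ + ‖b - Z‖ := norm_add_le _ _
      _ ≤ R + 1 := by rw [hbZ]; linarith
  have hZR : ‖Z‖ ≤ R + 1 := by linarith
  have hconc : (1 - t) * ∑ i ∈ s, Real.log (1 + inner ℝ Z (x i)) +
      t * ∑ i ∈ s, Real.log (1 + inner ℝ β (x i)) ≤
      ∑ i ∈ s, Real.log (1 + inner ℝ b (x i)) := by
    rw [Finset.mul_sum, Finset.mul_sum, ← Finset.sum_add_distrib]
    refine Finset.sum_le_sum fun i hi => ?_
    have := strictConcaveOn_log_Ioi.concaveOn.2 (Set.mem_Ioi.2 (hpos Z hZR i hi))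
      (Set.mem_Ioi.2 (hβ i hi)) (show 0 ≤ 1 - t by linarith) ht0 (by ring)
    simp only [smul_eq_mul] at this
    refine this.trans (le_of_eq ?_)
    congr 1
    rw [hb, inner_add_left, real_inner_smul_left, inner_sub_left]
    ring
  have h1 := abs_le.1 (hquad b hbR)
  have h2 := abs_le.1 (hquad Z hZR)
  rw [real_inner_self_eq_norm_sq] at h2
  -- Completing the square: at distance `ρ` from its maximiser the quadratic has dropped by `ρ² /
  -- 2`.
  have h3 : inner ℝ b Z - ‖b‖ ^ 2 / 2 = ‖Z‖ ^ 2 / 2 - ρ ^ 2 / 2 := by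
    have := @norm_sub_sq_real E _ _ b Z
    rw [hbZ] at this
    linarith
  rw [h3] at h1
  -- Concavity and near-maximality keep the value at `b` above the value at `Z` minus `ε`, so `ρ² /
  -- 2 ≤ 2η + ε`, contradicting `hsmall`.
  nlinarith

/-! ### Local expansion of the log-likelihood and localisation of its near-maximisers -/

section MaximumLikelihood

variable {X : Type*} {K : ℕ} {e : X → EuclideanSpace ℝ (Fin K)} {M : ℝ}

theorem normSum_eq_sum_range (e : X → EuclideanSpace ℝ (Fin K)) (n : ℕ) (y : ℕ → X) :
    normSum e n (fun i => y i) = (√(n : ℝ))⁻¹ • ∑ i ∈ Finset.range n, e (y i) := by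
  rw [normSum, Finset.sum_range]

theorem covDev_nonneg (e : X → EuclideanSpace ℝ (Fin K)) (n : ℕ) (y : ℕ → X) :
    0 ≤ covDev e n y :=
  Finset.sum_nonneg fun _ _ => Finset.sum_nonneg fun _ _ => abs_nonneg _

theorem abs_inner_rescaled_le (hM : ∀ x, ‖e x‖ ≤ M) {n : ℕ} {A : ℝ}
    {β : EuclideanSpace ℝ (Fin K)} (hβ : ‖β‖ ≤ A) (x : X) :
    |inner ℝ β ((√(n : ℝ))⁻¹ • e x)| ≤ A * M / √(n : ℝ) := by
  rw [real_inner_smul_right, abs_mul, abs_of_nonneg (by positivity : (0 : ℝ) ≤ (√(n : ℝ))⁻¹),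
    div_eq_inv_mul]
  refine mul_le_mul_of_nonneg_left ((abs_real_inner_le_norm _ _).trans ?_) (by positivity)
  exact mul_le_mul hβ (hM x) (norm_nonneg _) ((norm_nonneg _).trans hβ)

/-- Local quadratic expansion of the log-likelihood ratio. -/
theorem abs_sum_log_sub_quadratic_le (hM : ∀ x, ‖e x‖ ≤ M) {n : ℕ} (hn : n ≠ 0) (y : ℕ → X) {A : ℝ}
    (hA : A * M / √(n : ℝ) ≤ 1 / 2) {β : EuclideanSpace ℝ (Fin K)} (hβ : ‖β‖ ≤ A) :
    |∑ i ∈ Finset.range n, Real.log (1 + inner ℝ β ((√(n : ℝ))⁻¹ • e (y i))) -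
      (inner ℝ β (normSum e n fun i => y i) - ‖β‖ ^ 2 / 2)| ≤
      2 * (A * M) ^ 3 / √(n : ℝ) + A ^ 2 * covDev e n y / 2 := by
  have hn' : (0 : ℝ) < n := Nat.cast_pos.2 (Nat.pos_of_ne_zero hn)
  have hs : 0 < √(n : ℝ) := Real.sqrt_pos.2 hn'
  have hsq : √(n : ℝ) ^ 2 = n := Real.sq_sqrt hn'.le
  set u : ℕ → ℝ := fun i => inner ℝ β ((√(n : ℝ))⁻¹ • e (y i)) with hu
  have hub : ∀ i, |u i| ≤ A * M / √(n : ℝ) := fun i => abs_inner_rescaled_le hM hβ _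
  have h1 : ∑ i ∈ Finset.range n, u i = inner ℝ β (normSum e n fun i => y i) := by
    rw [normSum_eq_sum_range, Finset.smul_sum, inner_sum]
  have h2 : ∑ i ∈ Finset.range n, u i ^ 2 - ‖β‖ ^ 2 =
      (∑ i ∈ Finset.range n, (inner ℝ β (e (y i))) ^ 2 - n * ‖β‖ ^ 2) / n := by
    rw [sub_div, mul_div_cancel_left₀ _ hn'.ne', Finset.sum_div]
    congr 1
    refine Finset.sum_congr rfl fun i _ => ?_
    rw [hu]
    simp only [real_inner_smul_right, mul_pow, inv_pow, hsq]
    ring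
  have h3 : |∑ i ∈ Finset.range n, u i ^ 2 - ‖β‖ ^ 2| ≤ A ^ 2 * covDev e n y := by
    rw [h2, abs_div, abs_of_pos hn', div_le_iff₀ hn']
    refine (abs_sum_inner_sq_sub_le e hn y β).trans ?_
    have : ‖β‖ ^ 2 ≤ A ^ 2 := pow_le_pow_left₀ (norm_nonneg _) hβ 2
    have := mul_le_mul_of_nonneg_right this (mul_nonneg hn'.le (covDev_nonneg e n y))
    linarith
  -- There are `n` cubic remainders, each of order `n^{-3/2}`.
  have h4 : |∑ i ∈ Finset.range n, (Real.log (1 + u i) - (u i - u i ^ 2 / 2))| ≤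
      2 * (A * M) ^ 3 / √(n : ℝ) := by
    refine (Finset.abs_sum_le_sum_abs _ _).trans ?_
    calc ∑ i ∈ Finset.range n, |Real.log (1 + u i) - (u i - u i ^ 2 / 2)|
        ≤ ∑ i ∈ Finset.range n, 2 * (A * M / √(n : ℝ)) ^ 3 := by
          refine Finset.sum_le_sum fun i _ => ?_
          refine (abs_log_one_add_sub_le ((hub i).trans hA)).trans ?_
          have := pow_le_pow_left₀ (abs_nonneg _) (hub i) 3
          linarith
      _ = 2 * (A * M) ^ 3 / √(n : ℝ) := by
          rw [Finset.sum_const, Finset.card_range, nsmul_eq_mul, ← hsq, Real.sqrt_sq hs.le]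
          field_simp
  have h5 : ∑ i ∈ Finset.range n, Real.log (1 + u i) -
      (inner ℝ β (normSum e n fun i => y i) - ‖β‖ ^ 2 / 2) =
      ∑ i ∈ Finset.range n, (Real.log (1 + u i) - (u i - u i ^ 2 / 2)) -
        (∑ i ∈ Finset.range n, u i ^ 2 - ‖β‖ ^ 2) / 2 := by
    rw [Finset.sum_sub_distrib, Finset.sum_sub_distrib, h1, ← Finset.sum_div]
    ring
  change |∑ i ∈ Finset.range n, Real.log (1 + u i) - _| ≤ _
  rw [h5]
  refine (abs_sub _ _).trans ?_
  rw [abs_div, abs_two]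
  linarith

variable [MeasurableSpace X] {P : Measure X}
  {Ω : Type*} [MeasurableSpace Ω] {Pr : Measure Ω} {Y : ℕ → Ω → X}

theorem IsWhite.tendsto_measure_covDev_ge [IsProbabilityMeasure P] (he : IsWhite P e M)
    (hY : ∀ i, HasLaw (Y i) P Pr) (hind : iIndepFun Y Pr) {κ : ℝ} (hκ : 0 < κ) :
    Tendsto (fun n => Pr {ω | κ ≤ covDev e n fun i => Y i ω}) atTop (𝓝 0) := by
  have := hind.isProbabilityMeasure
  have hm : ∀ n, AEStronglyMeasurable (fun ω => covDev e n fun i => Y i ω) Pr := by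
    intro n
    refine AEMeasurable.aestronglyMeasurable ?_
    unfold covDev
    have h1 : ∀ i j, AEMeasurable (fun ω => e (Y i ω) j) Pr := fun i j => by
      have hj : Measurable fun v : EuclideanSpace ℝ (Fin K) => v j := by fun_prop
      exact hj.comp_aemeasurable (he.measurable.comp_aemeasurable (hY i).aemeasurable)
    fun_prop
  have := tendstoInMeasure_iff_norm.1
    (tendstoInMeasure_of_tendsto_ae hm (he.tendsto_covDev hY hind)) κ hκ
  refine this.congr fun n => ?_
  congr 1 with ω
  simp [abs_of_nonneg (covDev_nonneg e n fun i => Y i ω)]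

/-- With high probability, an approximate maximiser `b` of the log-likelihood ratio satisfies
`n ‖b‖² ≈ ‖Z‖²` and `2 ∑ log (1 + ⟪b, e (Y i)⟫) ≈ ‖Z‖²`, where `Z` is the normalised score sum. -/
theorem IsWhite.tendsto_measure_not_close [IsProbabilityMeasure P] (he : IsWhite P e M)
    (hY : ∀ i, HasLaw (Y i) P Pr) (hind : iIndepFun Y Pr)
    {b : ℕ → Ω → EuclideanSpace ℝ (Fin K)} {r : ℝ} (hr : 0 < r)
    (hb : ∀ ε : ℝ, 0 < ε → Tendsto (fun n => Pr {ω | ¬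
      ((∀ i < n, 0 < 1 + inner ℝ (b n ω) (e (Y i ω))) ∧
        ∀ c, ‖c‖ ≤ r → (∀ i < n, 0 < 1 + inner ℝ c (e (Y i ω))) →
          ∑ i ∈ Finset.range n, Real.log (1 + inner ℝ c (e (Y i ω))) ≤
            ∑ i ∈ Finset.range n, Real.log (1 + inner ℝ (b n ω) (e (Y i ω))) + ε)})
      atTop (𝓝 0)) (R : ℝ) {δ : ℝ} (hδ : 0 < δ) :
    Tendsto (fun n => Pr {ω | ‖normSum e n fun i => Y i ω‖ ^ 2 ≤ R ∧ ¬
      ((∀ i < n, 0 < 1 + inner ℝ (b n ω) (e (Y i ω))) ∧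
        |n * ‖b n ω‖ ^ 2 - ‖normSum e n fun i => Y i ω‖ ^ 2| ≤ δ ∧
        |2 * ∑ i ∈ Finset.range n, Real.log (1 + inner ℝ (b n ω) (e (Y i ω))) -
          ‖normSum e n fun i => Y i ω‖ ^ 2| ≤ δ)}) atTop (𝓝 0) := by
  -- `R` bounds the square of `‖Z‖`, and `R ≤ (|R| + 1)²`, so `R₀` bounds `‖Z‖` itself.
  set R₀ : ℝ := |R| + 1 with hR₀
  have hR₀1 : 1 ≤ R₀ := by rw [hR₀]; linarith [abs_nonneg R]
  -- If `√n b` is `ρ`-close to `Z`, the squared norms differ by at most `ρ (2 R₀ + 1)`.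
  set ρ : ℝ := min 1 (δ / (2 * R₀ + 1)) with hρ
  have hρ0 : 0 < ρ := lt_min one_pos (by positivity)
  have hρ1 : ρ ≤ 1 := min_le_left _ _
  have hρδ : ρ * (2 * R₀ + 1) ≤ δ := by
    rw [← le_div_iff₀ (by positivity)]
    exact min_le_right _ _
  -- `η` serves both as approximation error and as slack of the maximiser: `4η + 2η < ρ²`. Half of
  -- the approximation error comes from the cubic remainder, half from the covariance deviation,
  -- whence `κ`.
  set η : ℝ := ρ ^ 2 / 8 with hη
  have hη0 : 0 < η := by positivity
  set κ : ℝ := η / (R₀ + 1) ^ 2 with hκ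
  have hκ0 : 0 < κ := by positivity
  have hsqrt : Tendsto (fun n : ℕ => √(n : ℝ)) atTop atTop :=
    Real.tendsto_sqrt_atTop.comp tendsto_natCast_atTop_atTop
  have hsum := (hb η hη0).add (he.tendsto_measure_covDev_ge hY hind hκ0)
  rw [add_zero] at hsum
  refine tendsto_of_tendsto_of_tendsto_of_le_of_le' tendsto_const_nhds hsum
    (Eventually.of_forall fun _ => zero_le) ?_
  filter_upwards [eventually_gt_atTop 0,
    (hsqrt.const_div_atTop ((R₀ + 1) * M)).eventually_le_const (show (0 : ℝ) < 1 / 2 by norm_num),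
    (hsqrt.const_div_atTop (2 * ((R₀ + 1) * M) ^ 3)).eventually_le_const
      (show (0 : ℝ) < η / 2 by positivity),
    (hsqrt.const_div_atTop R₀).eventually_le_const hr] with n hn hn1 hn2 hn3
  refine (measure_mono ?_).trans (measure_union_le _ _)
  rintro ω ⟨hZ2, hω⟩
  by_contra hgood
  simp only [Set.mem_union, Set.mem_ofPred_eq, not_or, not_not, not_le] at hgood
  obtain ⟨⟨hbpos, hbmax⟩, hcov⟩ := hgood
  refine hω ⟨hbpos, ?_⟩
  have hn' : (0 : ℝ) < n := Nat.cast_pos.2 hn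
  have hs : 0 < √(n : ℝ) := Real.sqrt_pos.2 hn'
  set Z := normSum e n fun i => Y i ω with hZdef
  have hZ : ‖Z‖ ≤ R₀ := by
    have : ‖Z‖ ^ 2 ≤ R₀ ^ 2 := by nlinarith [le_abs_self R]
    exact le_of_sq_le_sq this (by linarith)
  have hinner : ∀ (β : EuclideanSpace ℝ (Fin K)) (x : X),
      inner ℝ (√(n : ℝ) • β) ((√(n : ℝ))⁻¹ • e x) = inner ℝ β (e x) := fun β x => by
    rw [real_inner_smul_left, real_inner_smul_right]
    field_simp
  have hinner' : ∀ (β : EuclideanSpace ℝ (Fin K)) (x : X),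
      inner ℝ β ((√(n : ℝ))⁻¹ • e x) = inner ℝ ((√(n : ℝ))⁻¹ • β) (e x) := fun β x => by
    rw [real_inner_smul_left, real_inner_smul_right]
  have hpos : ∀ β : EuclideanSpace ℝ (Fin K), ‖β‖ ≤ R₀ + 1 → ∀ i ∈ Finset.range n,
      0 < 1 + inner ℝ β ((√(n : ℝ))⁻¹ • e (Y i ω)) := fun β hβ i _ => by
    have := abs_le.1 ((abs_inner_rescaled_le he.norm_le hβ (Y i ω)).trans hn1)
    linarith
  have hquad : ∀ β : EuclideanSpace ℝ (Fin K), ‖β‖ ≤ R₀ + 1 →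
      |∑ i ∈ Finset.range n, Real.log (1 + inner ℝ β ((√(n : ℝ))⁻¹ • e (Y i ω))) -
        (inner ℝ β Z - ‖β‖ ^ 2 / 2)| ≤ η := fun β hβ => by
    refine (abs_sum_log_sub_quadratic_le he.norm_le hn.ne' (fun i => Y i ω) hn1 hβ).trans ?_
    have : (R₀ + 1) ^ 2 * covDev e n (fun i => Y i ω) ≤ η := by
      rw [← le_div_iff₀' (by positivity)]
      exact hcov.le
    linarith
  -- The competitor is `Z / √n`, which `hn3` places in the ball of radius `r`.
  have hmax : ∑ i ∈ Finset.range n, Real.log (1 + inner ℝ Z ((√(n : ℝ))⁻¹ • e (Y i ω))) ≤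
      ∑ i ∈ Finset.range n,
        Real.log (1 + inner ℝ (√(n : ℝ) • b n ω) ((√(n : ℝ))⁻¹ • e (Y i ω))) + η := by
    simp_rw [hinner, hinner']
    refine hbmax _ ?_ fun i hi => ?_
    · rw [norm_smul, Real.norm_of_nonneg (by positivity), ← div_eq_inv_mul]
      exact (div_le_div_of_nonneg_right hZ hs.le).trans hn3
    · rw [← hinner']
      exact hpos Z (by linarith) i (Finset.mem_range.2 hi)
  have hclose : ‖√(n : ℝ) • b n ω - Z‖ ≤ ρ :=
    norm_sub_le_of_approx_max (Finset.range n) (fun i => (√(n : ℝ))⁻¹ • e (Y i ω)) hρ0 hρ1 hZ hpos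
      hquad (fun i hi => by rw [hinner]; exact hbpos i (Finset.mem_range.1 hi)) hmax hη0.le (by
        rw [hη]; nlinarith)
  have hβnorm : ‖√(n : ℝ) • b n ω‖ ≤ R₀ + 1 := by
    have := norm_le_norm_add_norm_sub' (√(n : ℝ) • b n ω) Z
    linarith
  have hnb : n * ‖b n ω‖ ^ 2 = ‖√(n : ℝ) • b n ω‖ ^ 2 := by
    rw [norm_smul, mul_pow, Real.norm_of_nonneg hs.le, Real.sq_sqrt hn'.le]
  refine ⟨?_, ?_⟩
  · rw [hnb, sq_sub_sq, abs_mul]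
    have h1 := (abs_norm_sub_norm_le (√(n : ℝ) • b n ω) Z).trans hclose
    have h2 : |‖√(n : ℝ) • b n ω‖ + ‖Z‖| ≤ 2 * R₀ + 1 := by
      rw [abs_of_nonneg (by positivity)]
      linarith
    calc _ ≤ (2 * R₀ + 1) * ρ := mul_le_mul h2 h1 (abs_nonneg _) (by positivity)
      _ ≤ δ := by linarith
  · have h1 := abs_le.1 (hquad _ hβnorm)
    have h2 := abs_le.1 (hquad Z (by linarith))
    rw [real_inner_self_eq_norm_sq] at h2
    simp_rw [hinner] at h1 hmax
    -- The quadratic never exceeds its maximum `‖Z‖² / 2`, which gives the upper bound on the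
    -- likelihood ratio; the lower bound comes from near-maximality against `Z`.
    have h3 : inner ℝ (√(n : ℝ) • b n ω) Z - ‖√(n : ℝ) • b n ω‖ ^ 2 / 2 ≤ ‖Z‖ ^ 2 / 2 := by
      have := @norm_sub_sq_real (EuclideanSpace ℝ (Fin K)) _ _ (√(n : ℝ) • b n ω) Z
      nlinarith [sq_nonneg ‖√(n : ℝ) • b n ω - Z‖]
    have h4 : 4 * η ≤ δ := by
      rw [hη]; nlinarith
    rw [abs_le]
    constructor <;> linarith

end MaximumLikelihood

/-! ### Mixtures with bounded multiplicative perturbations of the mixing law -/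

/-- A positive definite symmetric bilinear form on a finite-dimensional space has an orthonormal
basis. -/
theorem exists_orthonormal_basis_of_posDef {V : Type*} [AddCommGroup V] [Module ℝ V]
    [FiniteDimensional ℝ V] (B : LinearMap.BilinForm ℝ V) (hs : ∀ x y, B x y = B y x)
    (hp : ∀ x ≠ 0, 0 < B x x) :
    ∃ u : Module.Basis (Fin (Module.finrank ℝ V)) ℝ V,
      ∀ i j, B (u i) (u j) = if i = j then 1 else 0 := by
  obtain ⟨v, hv⟩ := LinearMap.BilinForm.exists_orthogonal_basis (B := B) ⟨fun x y => hs x y⟩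
  have hvp : ∀ i, 0 < B (v i) (v i) := fun i => hp _ (v.ne_zero i)
  refine ⟨v.isUnitSMul (w := fun i => (√(B (v i) (v i)))⁻¹) fun i =>
    (inv_ne_zero (Real.sqrt_pos.2 (hvp i)).ne').isUnit, fun i j => ?_⟩
  simp only [Module.Basis.isUnitSMul_apply, map_smul, LinearMap.smul_apply, smul_eq_mul]
  split_ifs with hij
  · subst hij
    have := Real.mul_self_sqrt (hvp i).le
    have h0 := (Real.sqrt_pos.2 (hvp i)).ne'
    field_simp
    linarith
  · rw [hv hij]
    simp

/-! ### Scores as averages over the mixing law -/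

section Score

variable {d : ℕ} {Θ : Set (EuclideanSpace ℝ (Fin d))} {X : Type*}

/-- The function `(∫ p_θ(x) r(θ) dg₀(θ)) / f₀(x)`; it vanishes where `f₀ ∈ {0, ∞}`. -/
noncomputable def mixScore (p : Θ → X → ℝ≥0) (g₀ : Measure Θ) (r : Θ → ℝ) (x : X) : ℝ :=
  (∫ θ, (p θ x : ℝ) * r θ ∂g₀) / (mixDensity p g₀ x).toReal

variable {p : Θ → X → ℝ≥0} {g₀ : Measure Θ} {r : Θ → ℝ} {M : ℝ}

theorem mixScore_eq_zero {x : X} (hx : mixDensity p g₀ x = 0 ∨ mixDensity p g₀ x = ∞) :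
    mixScore p g₀ r x = 0 := by
  rcases hx with hx | hx <;> simp [mixScore, hx]

variable [MeasurableSpace X] {μ : Measure X}

theorem measurable_kernel_section (hp : Measurable (Function.uncurry p)) (x : X) :
    Measurable fun θ => p θ x :=
  hp.comp (measurable_id.prodMk measurable_const)

theorem measurable_mixDensity [SFinite g₀] (hp : Measurable (Function.uncurry p)) :
    Measurable (mixDensity p g₀) :=
  Measurable.lintegral_prod_left (f := fun θ x => (p θ x : ℝ≥0∞)) hp.coe_nnreal_ennreal

theorem measurable_mixScore [SFinite g₀] (hp : Measurable (Function.uncurry p))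
    (hr : Measurable r) : Measurable (mixScore p g₀ r) := by
  refine Measurable.div ?_ (measurable_mixDensity hp).ennreal_toReal
  have h : Measurable fun z : X × Θ => (p z.2 z.1 : ℝ) * r z.2 :=
    ((hp.comp measurable_swap).coe_nnreal_real).mul (hr.comp measurable_snd)
  exact (h.stronglyMeasurable.integral_prod_right (ν := g₀)).measurable

theorem integrable_kernel (hp : Measurable (Function.uncurry p)) {x : X}
    (hx : mixDensity p g₀ x ≠ ∞) : Integrable (fun θ => (p θ x : ℝ)) g₀ := by
  refine ⟨(measurable_kernel_section hp x).coe_nnreal_real.aestronglyMeasurable, ?_⟩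
  rw [hasFiniteIntegral_iff_ofNNReal]
  exact lt_top_iff_ne_top.2 hx

theorem integral_kernel (hp : Measurable (Function.uncurry p)) (x : X) :
    ∫ θ, (p θ x : ℝ) ∂g₀ = (mixDensity p g₀ x).toReal := by
  rw [integral_eq_lintegral_of_nonneg_ae (ae_of_all _ fun θ => (p θ x).coe_nonneg)
    (measurable_kernel_section hp x).coe_nnreal_real.aestronglyMeasurable]
  simp [mixDensity]

theorem integrable_kernel_mul (hp : Measurable (Function.uncurry p)) (hr : Measurable r)
    (hM : ∀ θ, |r θ| ≤ M) {x : X} (hx : mixDensity p g₀ x ≠ ∞) :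
    Integrable (fun θ => (p θ x : ℝ) * r θ) g₀ :=
  (integrable_kernel hp hx).mul_bdd hr.aestronglyMeasurable (ae_of_all _ hM)

theorem abs_integral_kernel_mul_le (hp : Measurable (Function.uncurry p)) (hr : Measurable r)
    (hM : ∀ θ, |r θ| ≤ M) {x : X} (hx : mixDensity p g₀ x ≠ ∞) :
    |∫ θ, (p θ x : ℝ) * r θ ∂g₀| ≤ M * (mixDensity p g₀ x).toReal := by
  rw [← integral_kernel hp, ← integral_const_mul]
  refine (abs_integral_le_integral_abs).trans (integral_mono
    (integrable_kernel_mul hp hr hM hx).abs ((integrable_kernel hp hx).const_mul M) fun θ => ?_)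
  simp only [abs_mul, NNReal.abs_eq]
  rw [mul_comm]
  exact mul_le_mul_of_nonneg_right (hM θ) (p θ x).coe_nonneg

/-- This also holds where `f₀ = 0`, despite the division: boundedness of `r` forces the numerator to
vanish there. -/
theorem toReal_mul_mixScore (hp : Measurable (Function.uncurry p)) (hr : Measurable r)
    (hM : ∀ θ, |r θ| ≤ M) {x : X} (hx : mixDensity p g₀ x ≠ ∞) :
    (mixDensity p g₀ x).toReal * mixScore p g₀ r x = ∫ θ, (p θ x : ℝ) * r θ ∂g₀ := by
  rcases eq_or_ne (mixDensity p g₀ x).toReal 0 with h | h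
  · have := abs_integral_kernel_mul_le hp hr hM hx
    rw [h, mul_zero] at this
    rw [h, zero_mul, abs_nonpos_iff.1 this]
  · rw [mixScore, mul_div_cancel₀ _ h]

/-- Where `0 < f₀ < ∞`, the score is the posterior mean of `r` given `x`, so it inherits the bound
on `r`; elsewhere it is `0`. -/
theorem abs_mixScore_le (hp : Measurable (Function.uncurry p)) (hr : Measurable r) (hM0 : 0 ≤ M)
    (hM : ∀ θ, |r θ| ≤ M) (x : X) : |mixScore p g₀ r x| ≤ M := by
  by_cases hx : mixDensity p g₀ x = 0 ∨ mixDensity p g₀ x = ∞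
  · rw [mixScore_eq_zero hx, abs_zero]; exact hM0
  · rw [not_or] at hx
    rw [mixScore, abs_div, ENNReal.abs_toReal, div_le_iff₀ (ENNReal.toReal_pos hx.1 hx.2)]
    exact abs_integral_kernel_mul_le hp hr hM hx.2

theorem mixScore_sum_smul (hp : Measurable (Function.uncurry p)) {ι : Type*} (s : Finset ι)
    {r : ι → Θ → ℝ} {M : ι → ℝ} (hr : ∀ i, Measurable (r i)) (hM : ∀ i θ, |r i θ| ≤ M i)
    (c : ι → ℝ) (x : X) :
    mixScore p g₀ (fun θ => ∑ i ∈ s, c i * r i θ) x = ∑ i ∈ s, c i * mixScore p g₀ (r i) x := by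
  by_cases hx : mixDensity p g₀ x = ∞
  · simp [mixScore_eq_zero (Or.inr hx)]
  · simp only [mixScore, ← mul_div_assoc]
    rw [← Finset.sum_div]
    congr 1
    have : ∀ θ, (p θ x : ℝ) * ∑ i ∈ s, c i * r i θ = ∑ i ∈ s, c i * ((p θ x : ℝ) * r i θ) :=
      fun θ => by
        rw [Finset.mul_sum]
        exact Finset.sum_congr rfl fun i _ => by ring
    simp_rw [this]
    rw [integral_finsetSum _ fun i _ =>
      (integrable_kernel_mul hp (hr i) (hM i) hx).const_mul (c i)]
    exact Finset.sum_congr rfl fun i _ => integral_const_mul _ _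

/-- The density of a mixture whose mixing law has density `1 + r` with respect to `g₀`. -/
theorem mixDensity_withDensity [SFinite g₀] (hp : Measurable (Function.uncurry p))
    (hr : Measurable r) (hM : ∀ θ, |r θ| ≤ M) (hnn : ∀ᵐ θ ∂g₀, 0 ≤ 1 + r θ) {x : X}
    (hx : mixDensity p g₀ x ≠ 0) (hx' : mixDensity p g₀ x ≠ ∞) :
    0 ≤ 1 + mixScore p g₀ r x ∧
    mixDensity p (g₀.withDensity fun θ => ENNReal.ofReal (1 + r θ)) x =
      mixDensity p g₀ x * ENNReal.ofReal (1 + mixScore p g₀ r x) := by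
  have hI : Integrable (fun θ => (p θ x : ℝ) * (1 + r θ)) g₀ := by
    simp_rw [mul_add, mul_one]
    exact (integrable_kernel hp hx').add (integrable_kernel_mul hp hr hM hx')
  have hI2 : ∫ θ, (p θ x : ℝ) * (1 + r θ) ∂g₀ =
      (mixDensity p g₀ x).toReal * (1 + mixScore p g₀ r x) := by
    simp_rw [mul_add, mul_one]
    rw [integral_add (integrable_kernel hp hx') (integrable_kernel_mul hp hr hM hx'),
      integral_kernel hp, toReal_mul_mixScore hp hr hM hx']
  have hnn' : 0 ≤ᵐ[g₀] fun θ => (p θ x : ℝ) * (1 + r θ) := by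
    filter_upwards [hnn] with θ hθ
    exact mul_nonneg (p θ x).coe_nonneg hθ
  have h0 := integral_nonneg_of_ae hnn'
  rw [hI2] at h0
  have hpos := ENNReal.toReal_pos hx hx'
  refine ⟨nonneg_of_mul_nonneg_right h0 hpos, ?_⟩
  have h1 : mixDensity p (g₀.withDensity fun θ => ENNReal.ofReal (1 + r θ)) x =
      ∫⁻ θ, ENNReal.ofReal ((p θ x : ℝ) * (1 + r θ)) ∂g₀ := by
    rw [mixDensity, lintegral_withDensity_eq_lintegral_mul _ (by fun_prop)
      (measurable_kernel_section hp x).coe_nnreal_ennreal]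
    refine lintegral_congr fun θ => ?_
    rw [Pi.mul_apply, mul_comm, ENNReal.ofReal_mul (p θ x).coe_nonneg, ENNReal.ofReal_coe_nnreal]
  rw [h1, ← ofReal_integral_eq_lintegral_ofReal hI hnn', hI2,
    ENNReal.ofReal_mul ENNReal.toReal_nonneg, ENNReal.ofReal_toReal hx']

variable [SigmaFinite μ] [IsProbabilityMeasure g₀]

theorem lintegral_mixDensity (hp : Measurable (Function.uncurry p))
    (hp1 : ∀ θ, ∫⁻ x, (p θ x : ℝ≥0∞) ∂μ = 1) : ∫⁻ x, mixDensity p g₀ x ∂μ = 1 := by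
  unfold mixDensity
  rw [lintegral_lintegral_swap]
  · simp [hp1]
  · exact (hp.comp measurable_swap).coe_nnreal_ennreal.aemeasurable

theorem isProbabilityMeasure_mixDensity (hp : Measurable (Function.uncurry p))
    (hp1 : ∀ θ, ∫⁻ x, (p θ x : ℝ≥0∞) ∂μ = 1) :
    IsProbabilityMeasure (μ.withDensity (mixDensity p g₀)) :=
  ⟨by rw [withDensity_apply _ MeasurableSet.univ, setLIntegral_univ, lintegral_mixDensity hp hp1]⟩

theorem ae_mixDensity_ne_top (hp : Measurable (Function.uncurry p))
    (hp1 : ∀ θ, ∫⁻ x, (p θ x : ℝ≥0∞) ∂μ = 1) : ∀ᵐ x ∂μ, mixDensity p g₀ x < ∞ :=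
  ae_lt_top (measurable_mixDensity hp) (by rw [lintegral_mixDensity hp hp1]; simp)

theorem ae_mixDensity_ne_zero_ne_top (hp : Measurable (Function.uncurry p))
    (hp1 : ∀ θ, ∫⁻ x, (p θ x : ℝ≥0∞) ∂μ = 1) :
    ∀ᵐ x ∂(μ.withDensity (mixDensity p g₀)), mixDensity p g₀ x ≠ 0 ∧ mixDensity p g₀ x ≠ ∞ := by
  rw [ae_withDensity_iff (measurable_mixDensity hp)]
  filter_upwards [ae_mixDensity_ne_top (g₀ := g₀) hp hp1] with x hx h0
  exact ⟨h0, hx.ne⟩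

/-- The factor `f₀` cancels the denominator; Fubini then integrates each `p_θ` to one. -/
theorem integral_mixScore (hp : Measurable (Function.uncurry p))
    (hp1 : ∀ θ, ∫⁻ x, (p θ x : ℝ≥0∞) ∂μ = 1) (hr : Measurable r) (hM : ∀ θ, |r θ| ≤ M) :
    ∫ x, mixScore p g₀ r x ∂(μ.withDensity (mixDensity p g₀)) = ∫ θ, r θ ∂g₀ := by
  rw [integral_withDensity_eq_integral_toReal_smul (measurable_mixDensity hp)
    (ae_mixDensity_ne_top hp hp1)]
  have h1 : ∫ x, (mixDensity p g₀ x).toReal • mixScore p g₀ r x ∂μ =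
      ∫ x, ∫ θ, (p θ x : ℝ) * r θ ∂g₀ ∂μ := by
    refine integral_congr_ae ?_
    filter_upwards [ae_mixDensity_ne_top (g₀ := g₀) hp hp1] with x hx
    exact toReal_mul_mixScore hp hr hM hx.ne
  have hpi : ∀ θ, ∫ x, (p θ x : ℝ) ∂μ = 1 := fun θ => by
    rw [integral_eq_lintegral_of_nonneg_ae (ae_of_all _ fun x => (p θ x).coe_nonneg)
      (hp.comp measurable_prodMk_left).coe_nnreal_real.aestronglyMeasurable]
    simp [hp1]
  have hint : Integrable (fun z : X × Θ => (p z.2 z.1 : ℝ) * r z.2) (μ.prod g₀) := by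
    have hint1 : Integrable (fun z : X × Θ => (p z.2 z.1 : ℝ)) (μ.prod g₀) := by
      refine ⟨(hp.comp measurable_swap).coe_nnreal_real.aestronglyMeasurable, ?_⟩
      have h2 := lintegral_prod (μ := μ) (ν := g₀) (fun z : X × Θ => (p z.2 z.1 : ℝ≥0∞))
        (hp.comp measurable_swap).coe_nnreal_ennreal.aemeasurable
      rw [hasFiniteIntegral_iff_ofNNReal, h2]
      exact (lintegral_mixDensity (g₀ := g₀) hp hp1).trans_lt ENNReal.one_lt_top
    exact hint1.mul_bdd (hr.comp measurable_snd).aestronglyMeasurable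
      (ae_of_all _ fun z => hM z.2)
  rw [h1, integral_integral_swap hint]
  refine integral_congr_ae (ae_of_all _ fun θ => ?_)
  simp only [integral_mul_const, hpi, one_mul]

end Score

/-! ### Polynomial perturbations of the mixing law and orthonormal coordinates -/

section Whitening

variable {d : ℕ} {Θ : Set (EuclideanSpace ℝ (Fin d))} {q : ℕ → MvPolynomial (Fin d) ℝ} {K : ℕ}

theorem measurable_polyEval (s : MvPolynomial (Fin d) ℝ) :
    Measurable (polyEval s : Θ → ℝ) := by
  have h : Continuous fun θ : Θ => fun i => (θ : EuclideanSpace ℝ (Fin d)) i := by fun_prop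
  exact ((MvPolynomial.continuous_eval s).comp h).measurable

theorem exists_abs_polyEval_le (hΘ : Bornology.IsBounded Θ) (s : MvPolynomial (Fin d) ℝ) :
    ∃ M : ℝ, ∀ θ : Θ, |polyEval s θ| ≤ M := by
  have h : Continuous fun θ : EuclideanSpace ℝ (Fin d) => MvPolynomial.eval (fun i => θ i) s :=
    (MvPolynomial.continuous_eval s).comp (by fun_prop)
  obtain ⟨M, hM⟩ := (hΘ.isCompact_closure.image h).isBounded.exists_norm_le
  exact ⟨M, fun θ => hM _ ⟨θ, subset_closure θ.2, rfl⟩⟩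

/-- The perturbation `∑_{k=1}^K c_k q_k(θ)`. -/
noncomputable def polyComb (q : ℕ → MvPolynomial (Fin d) ℝ) (c : Fin K → ℝ) (θ : Θ) : ℝ :=
  ∑ k : Fin K, c k * polyEval (q (k + 1)) θ

theorem weight_eq (c : Fin K → ℝ) (θ : Θ) : weight q c θ = 1 + polyComb q c θ := rfl

theorem measurable_polyComb (c : Fin K → ℝ) : Measurable (polyComb q c : Θ → ℝ) :=
  Finset.measurable_sum _ fun _ _ => (measurable_polyEval _).const_mul _

theorem abs_polyComb_le {Mq : ℕ → ℝ} (hMq : ∀ k, ∀ θ : Θ, |polyEval (q k) θ| ≤ Mq k)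
    (c : Fin K → ℝ) (θ : Θ) : |polyComb q c θ| ≤ ∑ k : Fin K, |c k| * Mq (k + 1) := by
  refine (Finset.abs_sum_le_sum_abs _ _).trans (Finset.sum_le_sum fun k _ => ?_)
  rw [abs_mul]
  exact mul_le_mul_of_nonneg_left (hMq _ θ) (abs_nonneg _)

theorem mixScore_polyComb {X : Type*} [MeasurableSpace X] {p : Θ → X → ℝ≥0} {g₀ : Measure Θ}
    (hp : Measurable (Function.uncurry p)) (hΘ : Bornology.IsBounded Θ)
    (c : Fin K → ℝ) (x : X) : mixScore p g₀ (polyComb q c) x =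
      ∑ k : Fin K, c k * mixScore p g₀ (polyEval (q (k + 1))) x := by
  choose Mq hMq using fun k => exists_abs_polyEval_le hΘ (q k)
  exact mixScore_sum_smul hp Finset.univ (fun k : Fin K => measurable_polyEval (q (k + 1)))
    (fun k θ => hMq (k + 1) θ) c x

variable {g₀ : Measure Θ} [IsProbabilityMeasure g₀]

theorem integrable_polyEval (hΘ : Bornology.IsBounded Θ) (s : MvPolynomial (Fin d) ℝ) :
    Integrable (polyEval s : Θ → ℝ) g₀ := by
  obtain ⟨M, hM⟩ := exists_abs_polyEval_le hΘ s
  exact Integrable.of_bound (measurable_polyEval s).aestronglyMeasurable M (ae_of_all _ hM)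

theorem integrable_polyComb (hΘ : Bornology.IsBounded Θ) (c : Fin K → ℝ) :
    Integrable (polyComb q c : Θ → ℝ) g₀ :=
  integrable_finsetSum _ fun _ _ => (integrable_polyEval hΘ _).const_mul _

theorem integral_polyComb (hΘ : Bornology.IsBounded Θ) (hq : IsOrthonormalPolySeq g₀ q)
    (c : Fin K → ℝ) : ∫ θ, polyComb q c θ ∂g₀ = 0 := by
  unfold polyComb
  rw [integral_finsetSum _ fun k _ => (integrable_polyEval hΘ _).const_mul _]
  refine Finset.sum_eq_zero fun k _ => ?_
  have := hq.2 0 (k + 1)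
  simp only [hq.1, one_mul] at this
  rw [integral_const_mul, this]
  simp

/-- Pairing the combination with `q_{l+1}` in `L₂(g₀)` returns the coefficient `c l`. -/
theorem eq_zero_of_polyComb_ae_eq_zero (hΘ : Bornology.IsBounded Θ)
    (hq : IsOrthonormalPolySeq g₀ q) {c : Fin K → ℝ} (hc : ∀ᵐ θ ∂g₀, polyComb q c θ = 0) :
    c = 0 := by
  funext l
  have h1 : ∫ θ, polyComb q c θ * polyEval (q (l + 1)) θ ∂g₀ = 0 := by
    rw [← integral_zero Θ ℝ (μ := g₀)]
    refine integral_congr_ae ?_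
    filter_upwards [hc] with θ hθ
    rw [hθ, zero_mul]
  have h2 : ∫ θ, polyComb q c θ * polyEval (q (l + 1)) θ ∂g₀ = c l := by
    simp_rw [polyComb, Finset.sum_mul, mul_assoc]
    have hi : ∀ k : Fin K, Integrable
        (fun θ => polyEval (q (k + 1)) θ * polyEval (q (l + 1)) θ) g₀ := fun k => by
      obtain ⟨M, hM⟩ := exists_abs_polyEval_le hΘ (q (l + 1))
      exact (integrable_polyEval hΘ _).mul_bdd (measurable_polyEval _).aestronglyMeasurable
        (ae_of_all _ hM)
    rw [integral_finsetSum _ fun k _ => (hi k).const_mul _]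
    simp_rw [integral_const_mul, hq.2]
    simp [Fin.val_inj]
  rw [← h2, h1]
  rfl

/-- The mixing law with density `1 + ∑ c_k q_k` with respect to `g₀`. -/
noncomputable def perturb (g₀ : Measure Θ) (q : ℕ → MvPolynomial (Fin d) ℝ) (c : Fin K → ℝ) :
    Measure Θ :=
  g₀.withDensity fun θ => ENNReal.ofReal (weight q c θ)

/-- Total mass one is automatic, since every `q_k` with `k ≥ 1` is orthogonal to `q₀ = 1`; only
nonnegativity has to be assumed. -/
theorem perturb_mem_submodel (hΘ : Bornology.IsBounded Θ) (hq : IsOrthonormalPolySeq g₀ q)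
    {c : Fin K → ℝ} (hc : ∀ᵐ θ ∂g₀, 0 ≤ weight q c θ) : perturb g₀ q c ∈ submodel g₀ q K := by
  refine ⟨⟨?_⟩, c, hc, rfl⟩
  have hi : Integrable (fun θ => weight q c θ) g₀ :=
    (integrable_const _).add (integrable_polyComb hΘ c)
  have h1 : ∫ θ, weight q c θ ∂g₀ = 1 := by
    simp_rw [weight_eq]
    rw [integral_add (integrable_const _) (integrable_polyComb hΘ c), integral_polyComb hΘ hq]
    simp
  rw [perturb, withDensity_apply _ MeasurableSet.univ, setLIntegral_univ,
    ← ofReal_integral_eq_lintegral_ofReal hi hc, h1, ENNReal.ofReal_one]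

theorem self_mem_submodel (hΘ : Bornology.IsBounded Θ) (hq : IsOrthonormalPolySeq g₀ q) :
    g₀ ∈ submodel g₀ q K := by
  have : perturb g₀ q (0 : Fin K → ℝ) = g₀ := by
    simp [perturb, weight]
  have h := perturb_mem_submodel (c := (0 : Fin K → ℝ)) hΘ hq
    (ae_of_all _ fun θ => by simp [weight])
  rwa [this] at h

variable {X : Type*} [MeasurableSpace X] {μ : Measure X} [SigmaFinite μ] {p : Θ → X → ℝ≥0}

/-- If `f = f₀ (1 + s)` wherever `0 < f₀ < ∞`, then `χ(f, f₀) = ‖s‖_{L₂(f₀ dμ)}`. -/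
theorem chi_eq_eLpNorm (hp : Measurable (Function.uncurry p))
    (hp1 : ∀ θ, ∫⁻ x, (p θ x : ℝ≥0∞) ∂μ = 1) {f : X → ℝ≥0∞} {s : X → ℝ}
    (hf : ∀ x, mixDensity p g₀ x ≠ 0 → mixDensity p g₀ x ≠ ∞ →
      0 ≤ 1 + s x ∧ f x = mixDensity p g₀ x * ENNReal.ofReal (1 + s x)) :
    chi μ f (mixDensity p g₀) = eLpNorm s 2 (μ.withDensity (mixDensity p g₀)) := by
  refine eLpNorm_congr_ae ?_
  filter_upwards [ae_mixDensity_ne_zero_ne_top (μ := μ) hp hp1] with x hx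
  obtain ⟨h1, h2⟩ := hf x hx.1 hx.2
  rw [h2, mul_comm, ENNReal.mul_div_cancel_right hx.1 hx.2, ENNReal.toReal_ofReal h1]
  ring

/-- The functions `(∫ p_θ q_k dg₀) / f₀`, `1 ≤ k ≤ K`, are linearly independent in `L₂(f₀ dμ)`. -/
theorem eq_zero_of_mixScore_ae_eq_zero (hp : Measurable (Function.uncurry p))
    (hp1 : ∀ θ, ∫⁻ x, (p θ x : ℝ≥0∞) ∂μ = 1) (hID : AssumptionID μ p g₀)
    (hq : IsOrthonormalPolySeq g₀ q) {c : Fin K → ℝ}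
    (hc : ∀ᵐ x ∂(μ.withDensity (mixDensity p g₀)), mixScore p g₀ (polyComb q c) x = 0) :
    c = 0 := by
  have hΘ := hID.1
  choose Mq hMq using fun k => exists_abs_polyEval_le hΘ (q k)
  set D : ℝ := ∑ k : Fin K, |c k| * Mq (k + 1) with hD
  have hcD : ∀ θ : Θ, |polyComb q c θ| ≤ D := abs_polyComb_le hMq c
  -- Scaling by `t` makes the perturbation at most `1` in absolute value, so that `1 + t ∑ c_k q_k`
  -- is the density of a genuine mixing law, to which (ID) applies.
  set t : ℝ := (|D| + 1)⁻¹ with ht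
  have ht0 : 0 < t := by positivity
  have hsc : ∀ θ : Θ, polyComb q (t • c) θ = t * polyComb q c θ := fun θ => by
    simp [polyComb, Finset.mul_sum, mul_assoc]
  have hsm : ∀ θ : Θ, |polyComb q (t • c) θ| ≤ 1 := fun θ => by
    rw [hsc, abs_mul, abs_of_pos ht0, ht, inv_mul_le_iff₀ (by positivity), mul_one]
    exact (hcD θ).trans ((le_abs_self D).trans (by linarith))
  have hw : ∀ θ : Θ, 0 ≤ weight q (t • c) θ := fun θ => by
    rw [weight_eq]
    linarith [(abs_le.1 (hsm θ)).1]
  have hmem := perturb_mem_submodel hΘ hq (ae_of_all g₀ hw)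
  have hchi : chiSq μ (mixDensity p (perturb g₀ q (t • c))) (mixDensity p g₀) = 0 := by
    have hchi' : chi μ (mixDensity p (perturb g₀ q (t • c))) (mixDensity p g₀) = _ :=
      chi_eq_eLpNorm hp hp1 fun x hx hx' =>
        mixDensity_withDensity hp (measurable_polyComb (t • c)) hsm (ae_of_all _ hw) hx hx'
    rw [chiSq, hchi']
    have : mixScore p g₀ (polyComb q (t • c)) =ᵐ[μ.withDensity (mixDensity p g₀)] 0 := by
      filter_upwards [hc] with x hx
      rw [mixScore_polyComb hp hΘ] at hx ⊢
      simp only [Pi.smul_apply, smul_eq_mul, mul_assoc, ← Finset.mul_sum, hx, mul_zero,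
        Pi.zero_apply]
    rw [eLpNorm_congr_ae this, eLpNorm_zero]
    simp
  have hg := (hID.2 _ hmem.1).1 hchi
  have h1 : (fun θ => ENNReal.ofReal (weight q (t • c) θ)) =ᵐ[g₀] fun _ => 1 := by
    rw [← withDensity_eq_iff_of_sigmaFinite]
    · change perturb g₀ q (t • c) = _
      rw [hg]
      simp
    · exact ((measurable_polyComb _).const_add 1).ennreal_ofReal.aemeasurable
    · exact aemeasurable_const
  refine eq_zero_of_polyComb_ae_eq_zero hΘ hq ?_
  filter_upwards [h1] with θ hθ
  rw [ENNReal.ofReal_eq_one, weight_eq, hsc] at hθ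
  have : t * polyComb q c θ = 0 := by linarith
  exact (mul_eq_zero.1 this).resolve_left ht0.ne'

/-- `b` is a coordinate vector of the density `f` relative to the score vector `e` and `f₀`. -/
def IsCoord (f₀ : X → ℝ≥0∞) (e : X → EuclideanSpace ℝ (Fin K)) (f : X → ℝ≥0∞)
    (b : EuclideanSpace ℝ (Fin K)) : Prop :=
  ∀ x, f₀ x ≠ 0 → f₀ x ≠ ∞ →
    0 ≤ 1 + inner ℝ b (e x) ∧ f x = f₀ x * ENNReal.ofReal (1 + inner ℝ b (e x))

/-- Whitened coordinates for the submodel. -/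
theorem exists_isWhite (hp : Measurable (Function.uncurry p))
    (hp1 : ∀ θ, ∫⁻ x, (p θ x : ℝ≥0∞) ∂μ = 1) (hID : AssumptionID μ p g₀)
    (hq : IsOrthonormalPolySeq g₀ q) :
    ∃ (e : X → EuclideanSpace ℝ (Fin K)) (M r : ℝ),
      IsWhite (μ.withDensity (mixDensity p g₀)) e M ∧ 0 < r ∧
      (∀ x, mixDensity p g₀ x = 0 ∨ mixDensity p g₀ x = ∞ → e x = 0) ∧
      (∀ g ∈ submodel g₀ q K, ∃ b, IsCoord (mixDensity p g₀) e (mixDensity p g) b) ∧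
      ∀ b : EuclideanSpace ℝ (Fin K), ‖b‖ ≤ r →
        ∃ g ∈ submodel g₀ q K, IsCoord (mixDensity p g₀) e (mixDensity p g) b := by
  have hΘ := hID.1
  choose Mq hMq using fun k => exists_abs_polyEval_le hΘ (q k)
  have hMq0 : ∀ k, 0 ≤ Mq k := by
    obtain ⟨θ⟩ : Nonempty Θ := by
      by_contra hne
      rw [not_nonempty_iff] at hne
      have := measure_univ (μ := g₀)
      simp [Set.univ_eq_empty_iff.2 hne] at this
    exact fun k => (abs_nonneg _).trans (hMq k θ)
  set P₀ := μ.withDensity (mixDensity p g₀) with hP₀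
  have hP₀prob : IsProbabilityMeasure P₀ := isProbabilityMeasure_mixDensity hp hp1
  set S : (Fin K → ℝ) → X → ℝ := fun c => mixScore p g₀ (polyComb q c) with hS
  have hSm : ∀ c, Measurable (S c) := fun c => measurable_mixScore hp (measurable_polyComb c)
  have hSb : ∀ c x, |S c x| ≤ ∑ k : Fin K, |c k| * Mq (k + 1) := fun c x =>
    abs_mixScore_le hp (measurable_polyComb c)
      (Finset.sum_nonneg fun k _ => mul_nonneg (abs_nonneg _) (hMq0 _)) (abs_polyComb_le hMq c) x
  have hSadd : ∀ c c' x, S (c + c') x = S c x + S c' x := fun c c' x => by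
    simp only [hS, mixScore_polyComb hp hΘ, Pi.add_apply, add_mul, Finset.sum_add_distrib]
  have hSsmul : ∀ (a : ℝ) c x, S (a • c) x = a * S c x := fun a c x => by
    simp only [hS, mixScore_polyComb hp hΘ, Pi.smul_apply, smul_eq_mul, mul_assoc, Finset.mul_sum]
  have hSi : ∀ c c', Integrable (fun x => S c x * S c' x) P₀ := fun c c' =>
    Integrable.mul_bdd (Integrable.of_bound (hSm c).aestronglyMeasurable _ (ae_of_all _ (hSb c)))
      (hSm c').aestronglyMeasurable (ae_of_all _ (hSb c'))
  let B : LinearMap.BilinForm ℝ (Fin K → ℝ) := LinearMap.mk₂ ℝ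
    (fun c c' => ∫ x, S c x * S c' x ∂P₀)
    (fun c₁ c₂ c' => by
      simp_rw [hSadd, add_mul]
      exact integral_add (hSi _ _) (hSi _ _))
    (fun a c c' => by
      simp_rw [hSsmul, mul_assoc]
      exact integral_const_mul _ _)
    (fun c c₁ c₂ => by
      simp_rw [hSadd, mul_add]
      exact integral_add (hSi _ _) (hSi _ _))
    (fun a c c' => by
      simp_rw [hSsmul, mul_left_comm]
      exact integral_const_mul _ _)
  have hB : ∀ c c', B c c' = ∫ x, S c x * S c' x ∂P₀ := fun c c' => rfl
  -- `B` is the Gram form of the scores in `L₂(f₀ dμ)`; its definiteness is their linear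
  -- independence, hence (ID).
  obtain ⟨u', hu'⟩ := exists_orthonormal_basis_of_posDef B
    (fun c c' => by simp_rw [hB, mul_comm])
    (fun c hc => by
      have h0 : 0 ≤ B c c := by
        rw [hB]
        exact integral_nonneg fun x => mul_self_nonneg _
      refine lt_of_le_of_ne h0 fun h => hc ?_
      rw [hB, eq_comm, integral_eq_zero_iff_of_nonneg (fun x => mul_self_nonneg _) (hSi c c)] at h
      refine eq_zero_of_mixScore_ae_eq_zero hp hp1 hID hq ?_
      filter_upwards [h] with x hx
      exact mul_self_eq_zero.1 hx)
  set u : Module.Basis (Fin K) ℝ (Fin K → ℝ) :=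
    u'.reindex (finCongr (by simp)) with hu
  have huB : ∀ i j, B (u i) (u j) = if i = j then 1 else 0 := fun i j => by
    simp only [hu, Module.Basis.reindex_apply, hu', EmbeddingLike.apply_eq_iff_eq]
  set e : X → EuclideanSpace ℝ (Fin K) := fun x => WithLp.toLp 2 fun j => S (u j) x with he
  -- `T` passes from whitened coordinates to polynomial coefficients.
  set T : EuclideanSpace ℝ (Fin K) → Fin K → ℝ := fun b => ∑ j, b j • u j with hT
  have hSsum : ∀ (b : Fin K → ℝ) x, S (∑ j, b j • u j) x = ∑ j, b j * S (u j) x := fun b x => by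
    let Sl : (Fin K → ℝ) →ₗ[ℝ] ℝ :=
      { toFun := fun c => S c x
        map_add' := fun c c' => hSadd c c' x
        map_smul' := fun a c => hSsmul a c x }
    change Sl _ = ∑ j, b j * Sl (u j)
    simp [map_sum]
  have hinner : ∀ b x, inner ℝ b (e x) = S (T b) x := fun b x => by
    rw [hT, hSsum]
    simp [he, PiLp.inner_apply, mul_comm]
  have hBT : ∀ b b', B (T b) (T b') = inner ℝ b b' := fun b b' => by
    simp [hT, huB, PiLp.inner_apply, mul_comm]
  set D : ℝ := ∑ k : Fin K, (∑ j, |u j k|) * Mq (k + 1) with hD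
  have hD0 : 0 ≤ D := Finset.sum_nonneg fun k _ =>
    mul_nonneg (Finset.sum_nonneg fun j _ => abs_nonneg _) (hMq0 _)
  have hTD : ∀ b (θ : Θ), |polyComb q (T b) θ| ≤ ‖b‖ * D := fun b θ => by
    refine (abs_polyComb_le hMq _ θ).trans ?_
    rw [hD, Finset.mul_sum]
    refine Finset.sum_le_sum fun k _ => ?_
    rw [← mul_assoc]
    refine mul_le_mul_of_nonneg_right ?_ (hMq0 _)
    simp only [hT, Finset.sum_apply, Pi.smul_apply, smul_eq_mul, Finset.mul_sum]
    refine (Finset.abs_sum_le_sum_abs _ _).trans (Finset.sum_le_sum fun j _ => ?_)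
    rw [abs_mul]
    exact mul_le_mul_of_nonneg_right (PiLp.norm_apply_le b j) (abs_nonneg _)
  have hcoord : ∀ b, (∀ᵐ θ ∂g₀, 0 ≤ weight q (T b) θ) →
      IsCoord (mixDensity p g₀) e (mixDensity p (perturb g₀ q (T b))) b := fun b hb x hx hx' => by
    rw [hinner]
    exact mixDensity_withDensity hp (measurable_polyComb (T b)) (hTD b) hb hx hx'
  -- `‖b‖ ≤ (D + 1)⁻¹` keeps the perturbation of the mixing law at most `1` in absolute value, hence
  -- its weight nonnegative.
  refine ⟨e, √(∑ j, (∑ k : Fin K, |u j k| * Mq (k + 1)) ^ 2), (D + 1)⁻¹, ⟨?_, ?_, ?_, ?_⟩,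
    by positivity, ?_, ?_, ?_⟩
  · exact (WithLp.measurable_toLp 2 _).comp (measurable_pi_lambda _ fun j => hSm _)
  · intro x
    rw [Real.le_sqrt (norm_nonneg _) (by positivity), EuclideanSpace.real_norm_sq_eq]
    refine Finset.sum_le_sum fun j _ => ?_
    exact sq_le_sq.2 ((hSb (u j) x).trans (le_abs_self _))
  · intro t
    simp_rw [hinner]
    exact (integral_mixScore hp hp1 (measurable_polyComb (T t)) (hTD t)).trans
      (integral_polyComb hΘ hq _)
  · intro s t
    simp_rw [hinner]
    exact hBT s t
  · intro x hx
    ext j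
    exact mixScore_eq_zero hx
  · rintro g ⟨-, c, hc, rfl⟩
    have hTc : T (WithLp.toLp 2 (u.repr c)) = c := by
      simp only [hT]
      exact u.sum_repr c
    refine ⟨WithLp.toLp 2 (u.repr c), ?_⟩
    have := hcoord (WithLp.toLp 2 (u.repr c))
    rw [hTc] at this
    exact this hc
  · intro b hb
    have hw : ∀ᵐ θ ∂g₀, 0 ≤ weight q (T b) θ := ae_of_all _ fun θ => by
      have h1 : ‖b‖ * D ≤ 1 := by
        calc ‖b‖ * D ≤ (D + 1)⁻¹ * D := mul_le_mul_of_nonneg_right hb hD0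
          _ ≤ 1 := by rw [inv_mul_le_iff₀ (by positivity)]; linarith
      rw [weight_eq]
      linarith [(abs_le.1 ((hTD b θ).trans h1)).1]
    exact ⟨_, perturb_mem_submodel hΘ hq hw, hcoord b hw⟩

end Whitening

/-! ### Donsker property of bounded finite-dimensional score classes -/

section Donsker

variable {X : Type*} [MeasurableSpace X] {K : ℕ} {P : Measure X}
  {e : X → EuclideanSpace ℝ (Fin K)} {M : ℝ}

theorem IsWhite.measurable_inner (he : IsWhite P e M) (b : EuclideanSpace ℝ (Fin K)) :
    Measurable fun x => inner ℝ b (e x) :=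
  Measurable.inner measurable_const he.measurable

theorem IsWhite.abs_inner_le (he : IsWhite P e M) (b : EuclideanSpace ℝ (Fin K)) (x : X) :
    |inner ℝ b (e x)| ≤ ‖b‖ * M :=
  (abs_real_inner_le_norm _ _).trans (mul_le_mul_of_nonneg_left (he.norm_le x) (norm_nonneg _))

theorem IsWhite.memLp_inner [IsFiniteMeasure P] (he : IsWhite P e M)
    (b : EuclideanSpace ℝ (Fin K)) : MemLp (fun x => inner ℝ b (e x)) 2 P :=
  MemLp.of_bound (he.measurable_inner b).aestronglyMeasurable _ (ae_of_all _ (he.abs_inner_le b))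

/-- Identity covariance makes `b ↦ ⟪b, e⟫` an isometry into `L₂`; this is how `χ` becomes the
Euclidean norm. -/
theorem IsWhite.eLpNorm_inner [IsFiniteMeasure P] (he : IsWhite P e M)
    (b : EuclideanSpace ℝ (Fin K)) :
    eLpNorm (fun x => inner ℝ b (e x)) 2 P = ENNReal.ofReal ‖b‖ := by
  rw [MemLp.eLpNorm_eq_integral_rpow_norm (by simp) (by simp) (he.memLp_inner b)]
  congr 1
  have h : ∀ x, ‖inner ℝ b (e x)‖ ^ (2 : ℝ≥0∞).toReal = inner ℝ b (e x) * inner ℝ b (e x) :=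
    fun x => by simp [pow_two]
  simp_rw [h]
  rw [he.cov, real_inner_self_eq_norm_sq, ENNReal.toReal_ofNat]
  exact_mod_cast Real.pow_rpow_inv_natCast (norm_nonneg b) two_ne_zero

/-- The evaluation of a vector against a family of vectors of norm at most one, as a continuous
linear map into `ℓ^∞`. -/
noncomputable def evalEllInf {S : Type*} (a : S → EuclideanSpace ℝ (Fin K)) (ha : ∀ s, ‖a s‖ ≤ 1) :
    EuclideanSpace ℝ (Fin K) →L[ℝ] EllInf S :=
  have hb : ∀ z s, ‖inner ℝ (a s) z‖ ≤ ‖z‖ := fun z s =>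
    (norm_inner_le_norm _ _).trans
      ((mul_le_mul_of_nonneg_right (ha s) (norm_nonneg _)).trans (one_mul _).le)
  LinearMap.mkContinuous
    { toFun := fun z => (⟨fun s => inner ℝ (a s) z, memℓp_infty
        ⟨‖z‖, by rintro _ ⟨s, rfl⟩; exact hb z s⟩⟩ : EllInf S)
      map_add' := fun z w => by
        ext s
        exact inner_add_right _ _ _
      map_smul' := fun c z => by
        ext s
        exact real_inner_smul_right _ _ _ } 1 fun z => by
    rw [one_mul]
    exact lp.norm_le_of_forall_le (norm_nonneg _) (hb z)

theorem evalEllInf_apply {S : Type*} (a : S → EuclideanSpace ℝ (Fin K)) (ha : ∀ s, ‖a s‖ ≤ 1)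
    (z : EuclideanSpace ℝ (Fin K)) (s : S) : evalEllInf a ha z s = inner ℝ (a s) z := rfl

/-- A class of functions `x ↦ ⟪a, e x⟫` with `‖a‖ ≤ 1` and `e` whitened is Donsker. -/
theorem IsWhite.isDonsker [IsProbabilityMeasure P] (he : IsWhite P e M) {S : Set (X → ℝ)}
    (hS : ∀ s ∈ S, ∃ a : EuclideanSpace ℝ (Fin K), ‖a‖ ≤ 1 ∧ ∀ x, s x = inner ℝ a (e x)) :
    IsDonsker P S := by
  choose a ha hsa using fun s : S => hS s.1 s.2
  have hs : ∀ s : S, s.1 = fun x => inner ℝ (a s) (e x) := fun s => funext (hsa s)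
  refine ⟨fun s hsS => ?_, ?_⟩
  · rw [show s = _ from hs ⟨s, hsS⟩]
    exact ⟨he.measurable_inner _, he.memLp_inner _⟩
  have hmean : ∀ s : S, ∫ y, s.1 y ∂P = 0 := fun s => by
    simp_rw [hsa s]
    exact he.mean _
  have hb : ∀ x, Memℓp (fun s : S => s.1 x - ∫ y, s.1 y ∂P) ∞ := fun x => by
    have := (evalEllInf a ha (e x)).2
    refine cast (congrArg (fun f : S → ℝ => Memℓp f ∞) ?_) this
    funext s
    rw [hmean, sub_zero, hsa s]
    rfl
  set T := evalEllInf a ha with hT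
  -- The scores have mean zero, so centring disappears and the process is exactly the image of the
  -- normalised sum. It is therefore measurable, although `ℓ^∞` need not be separable.
  have hemp : ∀ n, empiricalProcess P S hb n = fun x => T (normSum e n x) := fun n => by
    funext x
    ext s
    rw [hT, evalEllInf_apply, empiricalProcess, lp.coeFn_smul, lp.coeFn_sum, Pi.smul_apply,
      Finset.sum_apply, normSum, real_inner_smul_right, inner_sum, smul_eq_mul]
    congr 1
    refine Finset.sum_congr rfl fun i _ => ?_
    change s.1 (x i) - _ = _
    rw [hmean, sub_zero, hsa s]
  let mE : MeasurableSpace (EllInf S) := borel _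
  have : BorelSpace (EllInf S) := ⟨rfl⟩
  have hTm : Measurable T := T.continuous.measurable
  refine ⟨hb, (stdGaussian (EuclideanSpace ℝ (Fin K))).map T,
    Measure.isProbabilityMeasure_map hTm.aemeasurable, fun ε hε => ?_, fun h => ?_⟩
  · obtain ⟨C, hC, hCε⟩ := isTightMeasureSet_iff_exists_isCompact_measure_compl_le.1
      (isTightMeasureSet_singleton (μ := stdGaussian (EuclideanSpace ℝ (Fin K)))) ε hε
    refine ⟨T '' C, hC.image T.continuous, ?_⟩
    rw [Measure.map_apply hTm (hC.image T.continuous).isClosed.measurableSet.compl]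
    refine (measure_mono ?_).trans (hCε _ rfl)
    intro z hz hzC
    exact hz ⟨z, hzC, rfl⟩
  · have hlim : ∫ z, h z ∂((stdGaussian (EuclideanSpace ℝ (Fin K))).map T) =
        ∫ z, (h.compContinuous ⟨T, T.continuous⟩) z ∂(stdGaussian (EuclideanSpace ℝ (Fin K))) :=
      integral_map hTm.aemeasurable h.continuous.measurable.aestronglyMeasurable
    rw [hlim]
    refine (he.tendsto_integral_normSum _).congr fun n => ?_
    rw [hemp, outerExpectation_eq_integral (C := ‖h‖)]
    · rfl
    · exact (h.continuous.measurable.comp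
        (hTm.comp (measurable_normSum he.measurable n))).aemeasurable
    · exact fun x => h.norm_coe_le_norm _

end Donsker

/-! ### Log-likelihoods in coordinates -/

section LogLik

variable {X : Type*} {K : ℕ} {f₀ f : X → ℝ≥0∞}
  {e : X → EuclideanSpace ℝ (Fin K)} {b : EuclideanSpace ℝ (Fin K)} {n : ℕ} {y : ℕ → X}

theorem coe_finsetSum_ereal {ι : Type*} (s : Finset ι) (f : ι → ℝ) :
    ((∑ i ∈ s, f i : ℝ) : EReal) = ∑ i ∈ s, (f i : EReal) :=
  map_sum (⟨⟨Real.toEReal, EReal.coe_zero⟩, EReal.coe_add⟩ : ℝ →+ EReal) f s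

theorem logLik_eq_coe (hy : ∀ i, f₀ (y i) ≠ 0 ∧ f₀ (y i) ≠ ∞) :
    logLik n y f₀ = ((∑ i ∈ Finset.range n, Real.log (f₀ (y i)).toReal : ℝ) : EReal) := by
  rw [logLik, coe_finsetSum_ereal]
  exact Finset.sum_congr rfl fun i _ => ENNReal.log_pos_real (hy i).1 (hy i).2

theorem IsCoord.logLik_eq (hf : IsCoord f₀ e f b) (hy : ∀ i, f₀ (y i) ≠ 0 ∧ f₀ (y i) ≠ ∞)
    (hpos : ∀ i < n, 0 < 1 + inner ℝ b (e (y i))) :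
    logLik n y f = ((∑ i ∈ Finset.range n, Real.log (f₀ (y i)).toReal +
      ∑ i ∈ Finset.range n, Real.log (1 + inner ℝ b (e (y i))) : ℝ) : EReal) := by
  rw [logLik, ← Finset.sum_add_distrib, coe_finsetSum_ereal]
  refine Finset.sum_congr rfl fun i hi => ?_
  have hi' := hpos i (Finset.mem_range.1 hi)
  rw [(hf _ (hy i).1 (hy i).2).2, ENNReal.log_pos_real
    (mul_ne_zero (hy i).1 (ENNReal.ofReal_pos.2 hi').ne')
    (ENNReal.mul_ne_top (hy i).2 ENNReal.ofReal_ne_top), ENNReal.toReal_mul,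
    ENNReal.toReal_ofReal hi'.le,
    Real.log_mul (ENNReal.toReal_pos (hy i).1 (hy i).2).ne' hi'.ne']

/-- A single vanishing factor contributes `-∞`, which absorbs every other summand in `EReal`. -/
theorem IsCoord.pos_of_logLik_ne_bot (hf : IsCoord f₀ e f b)
    (hy : ∀ i, f₀ (y i) ≠ 0 ∧ f₀ (y i) ≠ ∞) (h : logLik n y f ≠ ⊥) :
    ∀ i < n, 0 < 1 + inner ℝ b (e (y i)) := by
  intro i hi
  obtain ⟨h1, h2⟩ := hf _ (hy i).1 (hy i).2
  refine lt_of_le_of_ne h1 fun h0 => h ?_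
  rw [← h0, ENNReal.ofReal_zero, mul_zero] at h2
  rw [logLik, ← Finset.add_sum_erase _ _ (Finset.mem_range.2 hi), h2, ENNReal.log_zero,
    EReal.bot_add]

end LogLik

/-! ### The chi-square law as the law of a squared Gaussian norm -/

theorem measurable_sum_sq (K : ℕ) : Measurable fun z : Fin K → ℝ => ∑ k, z k ^ 2 := by
  fun_prop

theorem integral_chiSquareLaw {K : ℕ} (h : ℝ →ᵇ ℝ) :
    ∫ z, h z ∂(chiSquareLaw K) =
      ∫ z, h (‖z‖ ^ 2) ∂(stdGaussian (EuclideanSpace ℝ (Fin K))) := by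
  rw [chiSquareLaw, integral_map (measurable_sum_sq K).aemeasurable h.continuous.aestronglyMeasurable,
    ← map_pi_eq_stdGaussian, integral_map (by fun_prop)]
  · simp [EuclideanSpace.real_norm_sq_eq]
  · exact (h.continuous.comp (by fun_prop)).aestronglyMeasurable

instance isProbabilityMeasure_chiSquareLaw (K : ℕ) : IsProbabilityMeasure (chiSquareLaw K) :=
  Measure.isProbabilityMeasure_map (measurable_sum_sq K).aemeasurable

/-! ### The assumptions for the submodels -/

section Submodel

variable {d : ℕ} {Θ : Set (EuclideanSpace ℝ (Fin d))} {q : ℕ → MvPolynomial (Fin d) ℝ} {K : ℕ}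
  {g₀ : Measure Θ} {X : Type*} [MeasurableSpace X] {μ : Measure X} {p : Θ → X → ℝ≥0}

/-- Mixing with `g₀` scales the coefficients: `(1 - t) + t (1 + ∑ c_k q_k)` is the weight of `t •
c`, and the mixture density is linear in the weight. -/
theorem assumptionSS_submodel (hp : Measurable (Function.uncurry p)) (hΘ : Bornology.IsBounded Θ)
    [IsProbabilityMeasure g₀] (hq : IsOrthonormalPolySeq g₀ q) :
    AssumptionSS (submodelDensities p g₀ q K) (mixDensity p g₀) := by
  rintro _ ⟨g, ⟨-, c, hc, rfl⟩, rfl⟩ t ht0 ht1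
  have hwt : ∀ θ : Θ, weight q (t • c) θ = (1 - t) + t * weight q c θ := fun θ => by
    simp only [weight, Pi.smul_apply, smul_eq_mul, mul_assoc, ← Finset.mul_sum]
    ring
  have hw : ∀ᵐ θ ∂g₀, 0 ≤ weight q (t • c) θ := by
    filter_upwards [hc] with θ hθ
    rw [hwt]
    have := mul_nonneg ht0 hθ
    linarith
  refine ⟨_, perturb_mem_submodel hΘ hq hw, ?_⟩
  have hwm : ∀ c : Fin K → ℝ, Measurable fun θ : Θ => ENNReal.ofReal (weight q c θ) := fun c =>
    ((measurable_polyComb c).const_add 1).ennreal_ofReal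
  funext x
  have hpx := (measurable_kernel_section hp x).coe_nnreal_ennreal
  unfold perturb mixDensity
  rw [lintegral_withDensity_eq_lintegral_mul _ (hwm _) hpx,
    lintegral_withDensity_eq_lintegral_mul _ (hwm _) hpx, ← lintegral_const_mul _ hpx,
    ← lintegral_const_mul _ ((hwm c).mul hpx), ← lintegral_add_left (hpx.const_mul _)]
  refine lintegral_congr_ae ?_
  filter_upwards [hc] with θ hθ
  simp only [Pi.mul_apply]
  rw [hwt, ENNReal.ofReal_add (by linarith) (mul_nonneg ht0 hθ), ENNReal.ofReal_mul ht0]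
  ring

variable [SigmaFinite μ] [IsProbabilityMeasure g₀] {e : X → EuclideanSpace ℝ (Fin K)} {M : ℝ}

theorem IsCoord.chi_eq (hp : Measurable (Function.uncurry p))
    (hp1 : ∀ θ, ∫⁻ x, (p θ x : ℝ≥0∞) ∂μ = 1)
    (he : IsWhite (μ.withDensity (mixDensity p g₀)) e M) {f : X → ℝ≥0∞}
    {b : EuclideanSpace ℝ (Fin K)} (hf : IsCoord (mixDensity p g₀) e f b) :
    chi μ f (mixDensity p g₀) = ENNReal.ofReal ‖b‖ := by
  have := isProbabilityMeasure_mixDensity (g₀ := g₀) hp hp1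
  rw [chi_eq_eLpNorm hp hp1 hf, he.eLpNorm_inner]

/-- By (ID), `f ≠ f₀` has a coordinate vector `b ≠ 0`, and its score is `⟪b / ‖b‖, e⟫`. The scores
thus come from unit vectors, and the bound on `‖e‖` is a constant envelope. -/
theorem assumptionA1_and_A2_submodel (hp : Measurable (Function.uncurry p))
    (hp1 : ∀ θ, ∫⁻ x, (p θ x : ℝ≥0∞) ∂μ = 1) (hID : AssumptionID μ p g₀)
    (he : IsWhite (μ.withDensity (mixDensity p g₀)) e M)
    (he0 : ∀ x, mixDensity p g₀ x = 0 ∨ mixDensity p g₀ x = ∞ → e x = 0)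
    (hcoord : ∀ g ∈ submodel g₀ q K, ∃ b, IsCoord (mixDensity p g₀) e (mixDensity p g) b) :
    AssumptionA1 μ (submodelDensities p g₀ q K) (mixDensity p g₀) ∧
      AssumptionA2 μ (submodelDensities p g₀ q K) (mixDensity p g₀) := by
  have hP := isProbabilityMeasure_mixDensity (g₀ := g₀) hp hp1
  have key : ∀ f ∈ submodelDensities p g₀ q K \ {mixDensity p g₀},
      ∃ b, IsCoord (mixDensity p g₀) e f b ∧ 0 < ‖b‖ := by
    rintro f ⟨⟨g, hg, rfl⟩, hne⟩
    obtain ⟨b, hb⟩ := hcoord g hg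
    refine ⟨b, hb, (norm_nonneg b).lt_of_ne fun h0 => hne ?_⟩
    have : g = g₀ := (hID.2 g hg.1).1 (by rw [chiSq, hb.chi_eq hp hp1 he, ← h0]; simp)
    rw [this]
    rfl
  have hscore : ∀ s ∈ scoreSet μ (submodelDensities p g₀ q K) (mixDensity p g₀),
      ∃ a : EuclideanSpace ℝ (Fin K), ‖a‖ ≤ 1 ∧ ∀ x, s x = inner ℝ a (e x) := by
    rintro _ ⟨f, hf, rfl⟩
    obtain ⟨b, hb, hb0⟩ := key f hf
    refine ⟨‖b‖⁻¹ • b, ?_, fun x => ?_⟩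
    · rw [norm_smul, norm_inv, norm_norm, inv_mul_cancel₀ hb0.ne']
    · rw [score, hb.chi_eq hp hp1 he, ENNReal.toReal_ofReal hb0.le]
      split_ifs with hx
      · rw [he0 x hx, inner_zero_right]
      · rw [not_or] at hx
        obtain ⟨h1, h2⟩ := hb x hx.1 hx.2
        rw [h2, mul_comm, ENNReal.mul_div_cancel_right hx.1 hx.2, ENNReal.toReal_ofReal h1,
          real_inner_smul_left]
        field_simp
        ring
  refine ⟨fun f hf => ?_, he.isDonsker hscore, fun _ => M, memLp_const M, fun s hs x => ?_⟩
  · obtain ⟨b, hb, hb0⟩ := key f hf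
    rw [chiSq, hb.chi_eq hp hp1 he]
    exact ⟨ENNReal.pow_pos (ENNReal.ofReal_pos.2 hb0) 2, ENNReal.pow_lt_top ENNReal.ofReal_lt_top⟩
  · obtain ⟨a, ha, hsa⟩ := hscore s hs
    rw [hsa]
    refine (he.abs_inner_le a x).trans ?_
    have hM : 0 ≤ M := (norm_nonneg _).trans (he.norm_le x)
    nlinarith

/-- The limit laws of the maximum likelihood estimator over the submodel. -/
theorem convergesInLaw_mle (hp : Measurable (Function.uncurry p))
    (hp1 : ∀ θ, ∫⁻ x, (p θ x : ℝ≥0∞) ∂μ = 1) (hΘ : Bornology.IsBounded Θ)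
    (hq : IsOrthonormalPolySeq g₀ q)
    (he : IsWhite (μ.withDensity (mixDensity p g₀)) e M) {r : ℝ} (hr : 0 < r)
    (hcoord : ∀ g ∈ submodel g₀ q K, ∃ b, IsCoord (mixDensity p g₀) e (mixDensity p g) b)
    (hball : ∀ b : EuclideanSpace ℝ (Fin K), ‖b‖ ≤ r →
      ∃ g ∈ submodel g₀ q K, IsCoord (mixDensity p g₀) e (mixDensity p g) b)
    {Ω : Type*} [MeasurableSpace Ω] {Pr : Measure Ω} [IsProbabilityMeasure Pr] {Y : ℕ → Ω → X}
    (hY : ∀ i, HasLaw (Y i) (μ.withDensity (mixDensity p g₀)) Pr) (hind : iIndepFun Y Pr)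
    {g : ℕ → Ω → Measure Θ} (hg : IsApproxMLE Pr Y p (submodel g₀ q K) g) :
    ConvergesInLaw (fun _ => Pr)
      (fun n ω => (n : ℝ) * (chiSq μ (mixDensity p (g n ω)) (mixDensity p g₀)).toReal)
      (chiSquareLaw K) ∧
    ConvergesInLaw (fun _ => Pr)
      (fun n ω => (2 : EReal) * (logLik n (fun i => Y i ω) (mixDensity p (g n ω)) -
        logLik n (fun i => Y i ω) (mixDensity p g₀)))
      ((chiSquareLaw K).map Real.toEReal) := by
  have hP := isProbabilityMeasure_mixDensity (g₀ := g₀) hp hp1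
  -- These coordinates may depend on `ω` in a non-measurable way; only outer probabilities of events
  -- about them are used.
  choose b hb using fun n ω => hcoord (g n ω) (hg.1 n ω)
  have hgood : ∀ᵐ ω ∂Pr, ∀ i, mixDensity p g₀ (Y i ω) ≠ 0 ∧ mixDensity p g₀ (Y i ω) ≠ ∞ := by
    refine ae_all_iff.2 fun i => ?_
    refine ae_of_ae_map (p := fun x => mixDensity p g₀ x ≠ 0 ∧ mixDensity p g₀ x ≠ ∞)
      (hY i).aemeasurable ?_
    rw [(hY i).map_eq]
    exact ae_mixDensity_ne_zero_ne_top hp hp1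
  have hchi : ∀ n ω, (chiSq μ (mixDensity p (g n ω)) (mixDensity p g₀)).toReal =
      ‖b n ω‖ ^ 2 := fun n ω => by
    rw [chiSq, (hb n ω).chi_eq hp hp1 he, ENNReal.toReal_pow,
      ENNReal.toReal_ofReal (norm_nonneg _)]
  have hclose := fun (R : ℝ) {δ : ℝ} (hδ : 0 < δ) =>
    he.tendsto_measure_not_close hY hind (b := b) hr (fun ε hε => by
      refine tendsto_of_tendsto_of_tendsto_of_le_of_le tendsto_const_nhds (hg.2 ε hε)
        (fun _ => zero_le) fun n => measure_mono_ae ?_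
      filter_upwards [hgood] with ω hω hbad
      by_contra hMLE
      refine hbad ?_
      have hsup : ∀ γ ∈ submodel g₀ q K, logLik n (fun i => Y i ω) (mixDensity p γ) ≤
          logLik n (fun i => Y i ω) (mixDensity p (g n ω)) + (ε : EReal) := fun γ hγ =>
        (le_iSup₂ (f := fun γ (_ : γ ∈ submodel g₀ q K) =>
          logLik n (fun i => Y i ω) (mixDensity p γ)) γ hγ).trans (not_lt.1 hMLE)
      -- `g₀` lies in the submodel and has a finite log-likelihood, so a near-maximiser cannot have
      -- log-likelihood `-∞`.
      have hpos : ∀ i < n, 0 < 1 + inner ℝ (b n ω) (e (Y i ω)) := by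
        refine (hb n ω).pos_of_logLik_ne_bot (y := fun i => Y i ω) hω fun hbot => ?_
        have h0 := hsup g₀ (self_mem_submodel hΘ hq)
        rw [hbot, EReal.bot_add, logLik_eq_coe (y := fun i => Y i ω) hω, le_bot_iff] at h0
        exact EReal.coe_ne_bot _ h0
      refine ⟨hpos, fun c hc hcpos => ?_⟩
      obtain ⟨γ, hγ, hγc⟩ := hball c hc
      have h1 := hsup γ hγ
      rw [hγc.logLik_eq (y := fun i => Y i ω) hω hcpos,
        (hb n ω).logLik_eq (y := fun i => Y i ω) hω hpos, ← EReal.coe_add,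
        EReal.coe_le_coe_iff] at h1
      linarith) R hδ
  have hsq : Continuous fun z : EuclideanSpace ℝ (Fin K) => ‖z‖ ^ 2 := by fun_prop
  have hWm : ∀ n, AEMeasurable (fun ω => ‖normSum e n fun i => Y i ω‖ ^ 2) Pr := fun n =>
    (hsq.measurable.comp (measurable_normSum he.measurable n)).comp_aemeasurable
      (hasLaw_fin_of_iIndepFun hY hind n).aemeasurable
  have hWL : ∀ h : ℝ →ᵇ ℝ, Tendsto (fun n => ∫ ω, h (‖normSum e n fun i => Y i ω‖ ^ 2) ∂Pr) atTop
      (𝓝 (∫ z, h z ∂(chiSquareLaw K))) := fun h => by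
    rw [integral_chiSquareLaw]
    exact he.tendsto_integral_sample hY hind (h.compContinuous ⟨_, hsq⟩)
  constructor
  · rw [← Measure.map_id (μ := chiSquareLaw K)]
    refine convergesInLaw_map_of_close continuous_id hWm hWL fun R δ hδ => ?_
    refine tendsto_of_tendsto_of_tendsto_of_le_of_le tendsto_const_nhds (hclose R hδ)
      (fun _ => zero_le) fun n => measure_mono ?_
    rintro ω ⟨h1, h2⟩
    refine ⟨(abs_of_nonneg (sq_nonneg _)).symm.le.trans h1, fun h3 => h2 ⟨_, rfl, ?_⟩⟩
    rw [hchi]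
    exact h3.2.1
  -- The likelihood ratio takes values in `EReal` and may be infinite on the bad event; off it, it
  -- is the embedding of a real number close to `‖Z_n‖²`.
  · refine convergesInLaw_map_of_close continuous_coe_real_ereal hWm hWL fun R δ hδ => ?_
    refine tendsto_of_tendsto_of_tendsto_of_le_of_le tendsto_const_nhds (hclose R hδ)
      (fun _ => zero_le) fun n => measure_mono_ae ?_
    filter_upwards [hgood] with ω hω
    rintro ⟨h1, h2⟩
    refine ⟨(abs_of_nonneg (sq_nonneg _)).symm.le.trans h1, fun h3 => h2 ⟨_, ?_, h3.2.2⟩⟩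
    rw [(hb n ω).logLik_eq (y := fun i => Y i ω) hω h3.1, logLik_eq_coe (y := fun i => Y i ω) hω,
      ← EReal.coe_sub, add_sub_cancel_left, EReal.coe_mul]
    rfl

end Submodel

end NPMixture

open NPMixture in
theorem mainTheorem12 {d m : ℕ} {Θ : Set (EuclideanSpace ℝ (Fin d))}
    (μ : Measure (EuclideanSpace ℝ (Fin m))) [SigmaFinite μ]
    (p : Θ → EuclideanSpace ℝ (Fin m) → ℝ≥0)
    (hp_meas : Measurable (Function.uncurry p))
    (hp_density : ∀ θ, ∫⁻ x, (p θ x : ℝ≥0∞) ∂μ = 1)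
    (g₀ : Measure Θ) [IsProbabilityMeasure g₀]
    (hID : AssumptionID μ p g₀)
    (q : ℕ → MvPolynomial (Fin d) ℝ) (hq : IsOrthonormalPolySeq g₀ q)
    (K : ℕ) (hK : 1 ≤ K) :
    (AssumptionA1 μ (submodelDensities p g₀ q K) (mixDensity p g₀) ∧
      AssumptionA2 μ (submodelDensities p g₀ q K) (mixDensity p g₀) ∧
      AssumptionSS (submodelDensities p g₀ q K) (mixDensity p g₀)) ∧
    ∀ (Ω : Type*) [MeasurableSpace Ω] (Pr : Measure Ω) [IsProbabilityMeasure Pr]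
      (Y : ℕ → Ω → EuclideanSpace ℝ (Fin m)),
      (∀ i, HasLaw (Y i) (μ.withDensity (mixDensity p g₀)) Pr) → iIndepFun Y Pr →
      ∀ g : ℕ → Ω → Measure Θ, IsApproxMLE Pr Y p (submodel g₀ q K) g →
        ConvergesInLaw (fun _ => Pr)
          (fun n ω => (n : ℝ) * (chiSq μ (mixDensity p (g n ω)) (mixDensity p g₀)).toReal)
          (chiSquareLaw K) ∧
        ConvergesInLaw (fun _ => Pr)
          (fun n ω => (2 : EReal) * (logLik n (fun i => Y i ω) (mixDensity p (g n ω)) -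
            logLik n (fun i => Y i ω) (mixDensity p g₀)))
          ((chiSquareLaw K).map Real.toEReal) := by
  obtain ⟨e, M, r, he, hr, he0, hcoord, hball⟩ :=
    exists_isWhite (K := K) hp_meas hp_density hID hq
  obtain ⟨hA1, hA2⟩ := assumptionA1_and_A2_submodel hp_meas hp_density hID he he0 hcoord
  refine ⟨⟨hA1, hA2, assumptionSS_submodel hp_meas hID.1 hq⟩, ?_⟩
  intro Ω _ Pr _ Y hY hind g hg
  exact convergesInLaw_mle hp_meas hp_density hID.1 hq he hr hcoord hball hY hind hg
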